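/- Theorem 2. For a finite simple graph $G$ and a set $F\subseteq E(G)$, let $G/F$ be the simple graph whose vertices are the connected components of the graph $(V(G),F)$, two distinct components being adjacent if and only if some edge of $G$ joins them. In the problem Maximum Degree Contraction the input is a finite simple graph $G$ on $n$ vertices together with integers $k,d\ge 0$, and the question is whether there is a set $F\subseteq E(G)$ with $|F|\le k$ such that every vertex of $G/F$ has degree at most $d$. There is a deterministic algorithm (a unit-cost random access machine over the natural numbers, with addition and truncated subtraction as its arithmetic, that receives $n$, $k$, $d$ and the adjacency matrix of $G$) that, on every instance $(G,k,d)$, halts after at most $2^{O(dk)}\cdot n^{O(1)}$ steps and correctly answers whether $(G,k,d)$ is a yes-instance. That is, there is a constant $C$ such that the number of steps is at most $C\cdot 2^{C d k}\cdot (n+1)^{C}$ for all $G$, $k$ and $d$. -/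

import Mathlib

namespace MaxDegContraction

/-! ### Edge contraction and the decision problem -/

/-- The graph `G / F`: its vertices are the connected components of the spanning graph `(V, F)`
(a vertex that no edge of `F` touches is a component by itself), and two distinct components are
adjacent when some edge of `G` joins them. -/
def contract {V : Type*} (G : SimpleGraph V) (F : Set (Sym2 V)) :
    SimpleGraph (SimpleGraph.fromEdgeSet F).ConnectedComponent where
  Adj A B := A ≠ B ∧ ∃ u ∈ A.supp, ∃ v ∈ B.supp, G.Adj u v
  symm := ⟨fun _ _ ⟨h, u, hu, v, hv, e⟩ => ⟨h.symm, v, hv, u, hu, e.symm⟩⟩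
  loopless := ⟨fun _ h => h.1 rfl⟩

/-- `(G, k, d)` is a yes-instance of Maximum Degree Contraction: some set `F` of at most `k` edges
of `G` is such that every vertex of `G / F` has degree at most `d`. -/
def IsYes {V : Type*} (G : SimpleGraph V) (k d : ℕ) : Prop :=
  ∃ F : Finset (Sym2 V), (F : Set (Sym2 V)) ⊆ G.edgeSet ∧ F.card ≤ k ∧
    ∀ A, ((contract G (F : Set (Sym2 V))).neighborSet A).ncard ≤ d

/-! ### Random access machines

Programs of a random access machine over the natural numbers, with unit cost, in structured form.
The machine has registers and arrays; a program is a finite text, so it names only finitely many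
of them. The arithmetic is addition and truncated subtraction (there is no multiplication, so
that unit cost is polynomially related to the time of a Turing machine). -/

/-- The state of the machine: `reg r` is the content of register `r`, and `arr a i` is the content
of cell `i` of array `a`. -/
structure State where
  reg : ℕ → ℕ
  arr : ℕ → ℕ → ℕ

/-- Write `x` into register `r`. -/
def State.setReg (s : State) (r x : ℕ) : State :=
  { s with reg := Function.update s.reg r x }

/-- Write `x` into cell `i` of array `a`. -/
def State.setArr (s : State) (a i x : ℕ) : State :=
  { s with arr := Function.update s.arr a (Function.update (s.arr a) i x) }

inductive Program where
  | skip : Program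
  /-- `r := c` for a constant `c` -/
  | const (r c : ℕ) : Program
  /-- `r := r₁` -/
  | copy (r r₁ : ℕ) : Program
  /-- `r := r₁ + r₂` -/
  | add (r r₁ r₂ : ℕ) : Program
  /-- `r := max (r₁ - r₂) 0` -/
  | sub (r r₁ r₂ : ℕ) : Program
  /-- `r := a[r₁]` -/
  | load (r a r₁ : ℕ) : Program
  /-- `a[r₁] := r₂` -/
  | store (a r₁ r₂ : ℕ) : Program
  /-- first `p`, then `q` -/
  | seq (p q : Program) : Program
  /-- if `r ≠ 0` then `p`, else `q` -/
  | ite (r : ℕ) (p q : Program) : Program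
  /-- while `r ≠ 0` do `p` -/
  | loop (r : ℕ) (p : Program) : Program

/-- `Runs p s t s'`: started in state `s`, the program `p` halts in state `s'` after exactly `t`
steps. Every elementary instruction and every evaluation of the test of a conditional or of a
loop is one step. -/
inductive Runs : Program → State → ℕ → State → Prop
  | skip (s : State) : Runs .skip s 1 s
  | const (r c : ℕ) (s : State) : Runs (.const r c) s 1 (s.setReg r c)
  | copy (r r₁ : ℕ) (s : State) : Runs (.copy r r₁) s 1 (s.setReg r (s.reg r₁))
  | add (r r₁ r₂ : ℕ) (s : State) :
      Runs (.add r r₁ r₂) s 1 (s.setReg r (s.reg r₁ + s.reg r₂))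
  | sub (r r₁ r₂ : ℕ) (s : State) :
      Runs (.sub r r₁ r₂) s 1 (s.setReg r (s.reg r₁ - s.reg r₂))
  | load (r a r₁ : ℕ) (s : State) :
      Runs (.load r a r₁) s 1 (s.setReg r (s.arr a (s.reg r₁)))
  | store (a r₁ r₂ : ℕ) (s : State) :
      Runs (.store a r₁ r₂) s 1 (s.setArr a (s.reg r₁) (s.reg r₂))
  | seq {p q : Program} {s s₁ s₂ : State} {t₁ t₂ : ℕ} (h₁ : Runs p s t₁ s₁)
      (h₂ : Runs q s₁ t₂ s₂) : Runs (.seq p q) s (t₁ + t₂) s₂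
  | iteTrue {r : ℕ} {p q : Program} {s s₁ : State} {t : ℕ} (hr : s.reg r ≠ 0)
      (h : Runs p s t s₁) : Runs (.ite r p q) s (t + 1) s₁
  | iteFalse {r : ℕ} {p q : Program} {s s₁ : State} {t : ℕ} (hr : s.reg r = 0)
      (h : Runs q s t s₁) : Runs (.ite r p q) s (t + 1) s₁
  | loopDone {r : ℕ} {p : Program} {s : State} (hr : s.reg r = 0) : Runs (.loop r p) s 1 s
  | loopStep {r : ℕ} {p : Program} {s s₁ s₂ : State} {t₁ t₂ : ℕ} (hr : s.reg r ≠ 0)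
      (h₁ : Runs p s t₁ s₁) (h₂ : Runs (.loop r p) s₁ t₂ s₂) :
      Runs (.loop r p) s (t₁ + t₂ + 1) s₂

/-- The machine is deterministic: the final state and the number of steps are determined by the
program and the initial state. -/
theorem Runs.deterministic {p : Program} {s s₁ s₂ : State} {t₁ t₂ : ℕ}
    (h₁ : Runs p s t₁ s₁) (h₂ : Runs p s t₂ s₂) : t₁ = t₂ ∧ s₁ = s₂ := by
  induction h₁ generalizing t₂ s₂ with
  | seq _ _ ih₁ ih₂ =>
    cases h₂ with
    | seq a b =>
      obtain ⟨rfl, rfl⟩ := ih₁ a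
      obtain ⟨rfl, rfl⟩ := ih₂ b
      exact ⟨rfl, rfl⟩
  | iteTrue hr _ ih =>
    cases h₂ with
    | iteTrue _ a =>
      obtain ⟨rfl, rfl⟩ := ih a
      exact ⟨rfl, rfl⟩
    | iteFalse hr' _ => exact absurd hr' hr
  | iteFalse hr _ ih =>
    cases h₂ with
    | iteTrue hr' _ => exact absurd hr hr'
    | iteFalse _ a =>
      obtain ⟨rfl, rfl⟩ := ih a
      exact ⟨rfl, rfl⟩
  | loopDone hr =>
    cases h₂ with
    | loopDone _ => exact ⟨rfl, rfl⟩
    | loopStep hr' _ _ => exact absurd hr hr'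
  | loopStep hr _ _ ih₁ ih₂ =>
    cases h₂ with
    | loopDone hr' => exact absurd hr' hr
    | loopStep _ a b =>
      obtain ⟨rfl, rfl⟩ := ih₁ a
      obtain ⟨rfl, rfl⟩ := ih₂ b
      exact ⟨rfl, rfl⟩
  | _ => cases h₂; exact ⟨rfl, rfl⟩

open Classical in
/-- The initial state on the instance `(G, k, d)`: registers `0`, `1`, `2` hold `n`, `k`, `d`, array
`0` holds the adjacency matrix of `G` row by row, and everything else is `0`. -/
noncomputable def inputState {n : ℕ} (G : SimpleGraph (Fin n)) (k d : ℕ) : State where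
  reg r := if r = 0 then n else if r = 1 then k else if r = 2 then d else 0
  arr a x := if a = 0 ∧ ∃ i j : Fin n, G.Adj i j ∧ x = i.val * n + j.val then 1 else 0

open Classical in
/-- On every instance, `P` halts within `T n k d` steps, where `n` is the number of vertices, and
leaves in register `0` the answer: `1` on yes-instances, `0` on no-instances. -/
def DecidesInTime (P : Program) (T : ℕ → ℕ → ℕ → ℕ) : Prop :=
  ∀ (n : ℕ) (G : SimpleGraph (Fin n)) (k d : ℕ), ∃ (t : ℕ) (s : State),
    Runs P (inputState G k d) t s ∧ t ≤ T n k d ∧ s.reg 0 = if IsYes G k d then 1 else 0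

end MaxDegContraction

namespace MaxDegContraction

/-! ### States -/

/-! The search runs over partitions of the vertices, starting from singletons. A class is bad if it
induces a disconnected graph or has more than `d` adjacent classes. A partition into at least `n -
k` classes, none of them bad, gives a solution: a spanning forest of the edges inside the classes
has exactly the classes as components, and its size is `n` minus their number
(`isYes_of_labelling`).

Conversely, fix a solution `F` and a partition whose classes lie inside components of `(V, F)`, and
let `x` be a bad class. If `x` has more than `d` neighbours, two of the `d + 2` classes formed by
`x` and its first `d + 1` neighbours lie in one component, since otherwise the component of `x`
would have degree above `d` in `G / F`. If `x` has at most `d` neighbours, it is disconnected, and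
an `F`-walk between two unlinked vertices of `x` must leave `x`, so `x` and one of its neighbours
lie in one component. Either way some two of the first `d + 2` entries of the list can be merged,
and the partition stays inside the components (`exists_pair_of_bad`). Merged classes need not be
adjacent, which is why disconnectedness counts as bad. Such a merge lowers the number of classes by
one, and `(V, F)` has at least `n - k` components, so at most `k` merges occur.

A pair of positions is coded by two digits `≤ d`. With `K = min k n` steps there are `(d + 1) ^ (2 *
K) ≤ 2 ^ (2 * d * k)` sequences of choices; a base `d + 1` counter enumerates them, and each is
simulated in time polynomial in `n`. On the machine side, everything but this enumeration is a
command built from for-loops, which has a denotation and a cost read off its syntax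
(`Cmd.runs_compile`); `den_simulate` and `den_nextChoices` identify the denotations. -/

@[simp] theorem State.setReg_reg (s : State) (r x r' : ℕ) :
    (s.setReg r x).reg r' = if r' = r then x else s.reg r' := by
  simp [State.setReg, Function.update_apply]

@[simp] theorem State.setReg_arr (s : State) (r x : ℕ) : (s.setReg r x).arr = s.arr := rfl

@[simp] theorem State.setArr_reg (s : State) (a i x : ℕ) : (s.setArr a i x).reg = s.reg := rfl

@[simp] theorem State.setArr_arr (s : State) (a i x a' : ℕ) :
    (s.setArr a i x).arr a' = if a' = a then Function.update (s.arr a) i x else s.arr a' := by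
  simp [State.setArr, Function.update_apply]

/-! ### Commands with bounded loops

Commands are programs whose only loops are of the form `for i < N`, where `N` is a register. They
always halt, so that they denote functions on states. Register `25` is reserved as a scratch
register. -/

inductive Cmd where
  | skip : Cmd
  | const (r c : ℕ) : Cmd
  | add (r r₁ r₂ : ℕ) : Cmd
  | sub (r r₁ r₂ : ℕ) : Cmd
  | load (r a r₁ : ℕ) : Cmd
  | store (a r₁ r₂ : ℕ) : Cmd
  | seq (p q : Cmd) : Cmd
  | ite (r : ℕ) (p q : Cmd) : Cmd
  /-- for `i` from `0` to `N - 1` do `p` -/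
  | rep (i N : ℕ) (p : Cmd) : Cmd

infixr:60 ";;" => Cmd.seq

namespace Cmd

/-- The program that a command stands for. -/
def compile : Cmd → Program
  | skip => .skip
  | const r c => .const r c
  | add r r₁ r₂ => .add r r₁ r₂
  | sub r r₁ r₂ => .sub r r₁ r₂
  | load r a r₁ => .load r a r₁
  | store a r₁ r₂ => .store a r₁ r₂
  | seq p q => .seq p.compile q.compile
  | ite r p q => .ite r p.compile q.compile
  | rep i N p => .seq (.const i 0) (.seq (.copy 25 N)
      (.loop 25 (.seq p.compile (.seq (.const 25 1) (.seq (.add i i 25) (.sub 25 N i))))))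

/-- The update of the counter `i` at the end of a round of a loop `for i < N`. -/
def tick (i N : ℕ) (s : State) : State :=
  ((s.setReg 25 1).setReg i (s.reg i + 1)).setReg 25 (s.reg N - (s.reg i + 1))

/-- The function on states that a command computes. -/
def den : Cmd → State → State
  | skip, s => s
  | const r c, s => s.setReg r c
  | add r r₁ r₂, s => s.setReg r (s.reg r₁ + s.reg r₂)
  | sub r r₁ r₂, s => s.setReg r (s.reg r₁ - s.reg r₂)
  | load r a r₁, s => s.setReg r (s.arr a (s.reg r₁))
  | store a r₁ r₂, s => s.setArr a (s.reg r₁) (s.reg r₂)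
  | seq p q, s => q.den (p.den s)
  | ite r p q, s => if s.reg r = 0 then q.den s else p.den s
  | rep i N p, s => (fun s' => tick i N (p.den s'))^[s.reg N]
      ((s.setReg i 0).setReg 25 (s.reg N))

@[simp] theorem den_skip (s : State) : skip.den s = s := rfl

@[simp] theorem den_const (r c : ℕ) (s : State) : (const r c).den s = s.setReg r c := rfl

@[simp] theorem den_add (r r₁ r₂ : ℕ) (s : State) :
    (add r r₁ r₂).den s = s.setReg r (s.reg r₁ + s.reg r₂) := rfl

@[simp] theorem den_sub (r r₁ r₂ : ℕ) (s : State) :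
    (sub r r₁ r₂).den s = s.setReg r (s.reg r₁ - s.reg r₂) := rfl

@[simp] theorem den_load (r a r₁ : ℕ) (s : State) :
    (load r a r₁).den s = s.setReg r (s.arr a (s.reg r₁)) := rfl

@[simp] theorem den_store (a r₁ r₂ : ℕ) (s : State) :
    (store a r₁ r₂).den s = s.setArr a (s.reg r₁) (s.reg r₂) := rfl

@[simp] theorem den_seq (p q : Cmd) (s : State) : (p ;; q).den s = q.den (p.den s) := rfl

theorem den_ite_of_ne {r : ℕ} {p q : Cmd} {s : State} (h : s.reg r ≠ 0) :
    (ite r p q).den s = p.den s := if_neg h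

theorem den_ite_of_eq {r : ℕ} {p q : Cmd} {s : State} (h : s.reg r = 0) :
    (ite r p q).den s = q.den s := if_pos h

/-- Whether the command may write to register `r`. -/
def writesReg : Cmd → ℕ → Bool
  | skip, _ => false
  | const r _, x => x == r
  | add r _ _, x => x == r
  | sub r _ _, x => x == r
  | load r _ _, x => x == r
  | store _ _ _, _ => false
  | seq p q, x => p.writesReg x || q.writesReg x
  | ite _ p q, x => p.writesReg x || q.writesReg x
  | rep i _ p, x => x == i || x == 25 || p.writesReg x

/-- Whether the command may write to array `a`. -/
def writesArr : Cmd → ℕ → Bool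
  | store a _ _, x => x == a
  | seq p q, x => p.writesArr x || q.writesArr x
  | ite _ p q, x => p.writesArr x || q.writesArr x
  | rep _ _ p, x => p.writesArr x
  | _, _ => false

/-- All loops are bounded by registers from the list `bs`, which the command does not write to, and
no loop changes its own counter. -/
def ok (bs : List ℕ) : Cmd → Bool
  | seq p q => p.ok bs && q.ok bs
  | ite _ p q => p.ok bs && q.ok bs
  | rep i N p => decide (N ∈ bs) && decide (i ∉ bs) && decide (25 ∉ bs) && i != 25 &&
      !p.writesReg i && p.ok bs
  | skip => true
  | const r _ => decide (r ∉ bs)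
  | add r _ _ => decide (r ∉ bs)
  | sub r _ _ => decide (r ∉ bs)
  | load r _ _ => decide (r ∉ bs)
  | store _ _ _ => true

/-- A bound on the number of steps, when all loops have at most `B` rounds. -/
def cost (B : ℕ) : Cmd → ℕ
  | seq p q => p.cost B + q.cost B
  | ite _ p q => p.cost B + q.cost B + 1
  | rep _ _ p => B * (p.cost B + 4) + 3
  | _ => 1

/-! ### Polynomial cost, and what a command leaves unchanged. -/

theorem cost_le (c : Cmd) : ∃ C, ∀ B, c.cost B ≤ C * (B + 1) ^ C := by
  have base : ∃ C : ℕ, ∀ B : ℕ, 1 ≤ C * (B + 1) ^ C := ⟨1, fun B => by simp⟩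
  have pos : ∀ C B : ℕ, 1 ≤ (B + 1) ^ C := fun C B => Nat.one_le_pow _ _ (by omega)
  induction c with
  | seq p q ihp ihq =>
    obtain ⟨C, hC⟩ := ihp
    obtain ⟨D, hD⟩ := ihq
    refine ⟨C + D, fun B => ?_⟩
    have h1 := Nat.mul_le_mul_left C (Nat.pow_le_pow_right (Nat.succ_pos B) (Nat.le_add_right C D))
    have h2 := Nat.mul_le_mul_left D (Nat.pow_le_pow_right (Nat.succ_pos B) (Nat.le_add_left D C))
    have := hC B
    have := hD B
    simp only [cost, Nat.add_mul]
    simp only [Nat.succ_eq_add_one] at h1 h2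
    omega
  | ite r p q ihp ihq =>
    obtain ⟨C, hC⟩ := ihp
    obtain ⟨D, hD⟩ := ihq
    refine ⟨C + D + 1, fun B => ?_⟩
    have h1 := Nat.mul_le_mul_left C
      (Nat.pow_le_pow_right (Nat.succ_pos B) (by omega : C ≤ C + D + 1))
    have h2 := Nat.mul_le_mul_left D
      (Nat.pow_le_pow_right (Nat.succ_pos B) (by omega : D ≤ C + D + 1))
    have := hC B
    have := hD B
    have := pos (C + D + 1) B
    simp only [cost, Nat.add_mul, Nat.one_mul]
    simp only [Nat.succ_eq_add_one] at h1 h2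
    omega
  | rep i N p ih =>
    obtain ⟨C, hC⟩ := ih
    -- The loop costs at most `B * (C * (B + 1) ^ C + 4) + 3`: one more factor `B + 1`, and `4 + 3`
    -- added to the coefficient.
    refine ⟨C + 7, fun B => ?_⟩
    have h1 : (B + 1) ^ (C + 1) ≤ (B + 1) ^ (C + 7) := Nat.pow_le_pow_right (by omega) (by omega)
    have h2 := pos C B
    have h3 := Nat.mul_le_mul_left B (hC B)
    have h4 := Nat.mul_le_mul_left B h2
    have h5 := Nat.mul_le_mul_left (C + 7) h1
    simp only [cost]
    rw [pow_succ] at h5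
    refine le_trans ?_ h5
    nlinarith [Nat.zero_le (C * (B + 1) ^ C)]
  | _ => exact base

/-- The hypothesis is a syntactic check, so for a concrete command and register it is discharged by
`rfl`; every later framing argument uses it this way. -/
theorem den_reg {c : Cmd} {r : ℕ} (h : c.writesReg r = false) (s : State) :
    (c.den s).reg r = s.reg r := by
  induction c generalizing s with
  | seq p q ihp ihq =>
    simp only [writesReg, Bool.or_eq_false_iff] at h
    simp only [den, ihq h.2, ihp h.1]
  | ite r' p q ihp ihq =>
    simp only [writesReg, Bool.or_eq_false_iff] at h
    simp only [den]
    split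
    · exact ihq h.2 s
    · exact ihp h.1 s
  | rep i N p ih =>
    simp only [writesReg, Bool.or_eq_false_iff, beq_eq_false_iff_ne] at h
    obtain ⟨⟨h1, h2⟩, h3⟩ := h
    have aux : ∀ (m : ℕ) (s' : State),
        ((fun s' => tick i N (p.den s'))^[m] s').reg r = s'.reg r := by
      intro m
      induction m with
      | zero => intro s'; rfl
      | succ m ihm =>
        intro s'
        rw [Function.iterate_succ_apply, ihm]
        simp [tick, h1, h2, ih h3]
    simp only [den, aux]
    simp [h1, h2]
  | _ => simp_all [den, writesReg]

theorem den_arr {c : Cmd} {a : ℕ} (h : c.writesArr a = false) (s : State) :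
    (c.den s).arr a = s.arr a := by
  induction c generalizing s with
  | seq p q ihp ihq =>
    simp only [writesArr, Bool.or_eq_false_iff] at h
    simp only [den, ihq h.2, ihp h.1]
  | ite r' p q ihp ihq =>
    simp only [writesArr, Bool.or_eq_false_iff] at h
    simp only [den]
    split
    · exact ihq h.2 s
    · exact ihp h.1 s
  | rep i N p ih =>
    simp only [writesArr] at h
    have aux : ∀ (m : ℕ) (s' : State),
        ((fun s' => tick i N (p.den s'))^[m] s').arr a = s'.arr a := by
      intro m
      induction m with
      | zero => intro s'; rfl
      | succ m ihm =>
        intro s'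
        rw [Function.iterate_succ_apply, ihm]
        simp [tick, ih h]
    simp only [den, aux]
    simp
  | _ => simp_all [den, writesArr]

/-- This keeps the bound `B` on the loop registers valid throughout a run. -/
theorem writesReg_of_ok {bs : List ℕ} {c : Cmd} (h : c.ok bs = true) {r : ℕ} (hr : r ∈ bs) :
    c.writesReg r = false := by
  induction c with
  | rep i N p ih =>
    simp only [ok, Bool.and_eq_true, decide_eq_true_eq] at h
    obtain ⟨⟨⟨⟨⟨-, h1⟩, h2⟩, -⟩, -⟩, h3⟩ := h
    simp only [writesReg, Bool.or_eq_false_iff, beq_eq_false_iff_ne]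
    exact ⟨⟨fun e => h1 (e ▸ hr), fun e => h2 (e ▸ hr)⟩, ih h3⟩
  | store => rfl
  | skip => rfl
  | seq p q ihp ihq =>
    simp only [ok, Bool.and_eq_true] at h
    simp [writesReg, ihp h.1, ihq h.2]
  | ite r' p q ihp ihq =>
    simp only [ok, Bool.and_eq_true] at h
    simp [writesReg, ihp h.1, ihq h.2]
  | _ =>
    simp only [ok, decide_eq_true_eq] at h
    simp only [writesReg, beq_eq_false_iff_ne]
    exact fun e => h (e ▸ hr)

/-- A command whose loops are bounded halts within its cost, in the state it denotes. -/
theorem runs_compile {bs : List ℕ} {c : Cmd} (h : c.ok bs = true) {B : ℕ} {s : State}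
    (hB : ∀ r ∈ bs, s.reg r ≤ B) : ∃ t ≤ c.cost B, Runs c.compile s t (c.den s) := by
  induction c generalizing s with
  | seq p q ihp ihq =>
    simp only [ok, Bool.and_eq_true] at h
    obtain ⟨t₁, ht₁, r₁⟩ := ihp h.1 hB
    obtain ⟨t₂, ht₂, r₂⟩ := ihq h.2 (s := p.den s) fun r hr => by
      rw [den_reg (writesReg_of_ok h.1 hr)]; exact hB r hr
    exact ⟨t₁ + t₂, Nat.add_le_add ht₁ ht₂, .seq r₁ r₂⟩
  | ite r p q ihp ihq =>
    simp only [ok, Bool.and_eq_true] at h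
    by_cases hr : s.reg r = 0
    · obtain ⟨t, ht, r⟩ := ihq h.2 hB
      refine ⟨t + 1, by simp only [cost]; omega, ?_⟩
      simp only [den, hr, if_true]
      exact .iteFalse hr r
    · obtain ⟨t, ht, r⟩ := ihp h.1 hB
      refine ⟨t + 1, by simp only [cost]; omega, ?_⟩
      simp only [den, hr, if_false]
      exact .iteTrue hr r
  | rep i N p ih =>
    simp only [ok, Bool.and_eq_true, decide_eq_true_eq, bne_iff_ne, Bool.not_eq_true'] at h
    obtain ⟨⟨⟨⟨⟨hN, hi⟩, h25⟩, hi25⟩, hpi⟩, hp⟩ := h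
    have hNi : N ≠ i := fun e => hi (e ▸ hN)
    have hN25 : N ≠ 25 := fun e => h25 (e ▸ hN)
    -- Register `25` holds the number `m` of rounds left at each test. The body may overwrite it, so
    -- it is recomputed as `N - i` after every round. The `4` counts the test and the three
    -- instructions of the tick; the final `1` is the failing test.
    have loop : ∀ (m j : ℕ) (s' : State), (∀ r ∈ bs, s'.reg r ≤ B) → s'.reg i = j →
        s'.reg N = j + m → s'.reg 25 = m →
        ∃ t ≤ m * (p.cost B + 4) + 1, Runs
          (.loop 25 (.seq p.compile (.seq (.const 25 1) (.seq (.add i i 25) (.sub 25 N i))))) s' t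
          ((fun s' => tick i N (p.den s'))^[m] s') := by
      intro m
      induction m with
      | zero =>
        intro j s' _ _ _ h25
        exact ⟨1, by omega, .loopDone h25⟩
      | succ m ihm =>
        intro j s' hB' hij hNj h25j
        obtain ⟨t₁, ht₁, r₁⟩ := ih hp hB'
        have hregi : (p.den s').reg i = j := by rw [den_reg hpi, hij]
        have hregN : (p.den s').reg N = j + (m + 1) := by
          rw [den_reg (writesReg_of_ok hp hN), hNj]
        have htick : Runs (.seq (.const 25 1) (.seq (.add i i 25) (.sub 25 N i))) (p.den s') 3
            (tick i N (p.den s')) := by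
          have h1 := Runs.const 25 1 (p.den s')
          have h2 := Runs.add i i 25 ((p.den s').setReg 25 1)
          have h3 := Runs.sub 25 N i (((p.den s').setReg 25 1).setReg i ((p.den s').reg i + 1))
          simp only [State.setReg_reg, if_true, hi25, if_false] at h2
          simp only [State.setReg_reg, if_true, hNi, hN25, if_false] at h3
          exact Runs.seq h1 (Runs.seq h2 h3)
        obtain ⟨t₂, ht₂, r₂⟩ := ihm (j + 1) (tick i N (p.den s'))
          (fun r hr => by
            have hri : r ≠ i := fun e => hi (e ▸ hr)
            have hr25 : r ≠ 25 := fun e => h25 (e ▸ hr)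
            simp only [tick, State.setReg_reg, hri, hr25, if_false]
            rw [den_reg (writesReg_of_ok hp hr)]; exact hB' r hr)
          (by simp [tick, hi25, hregi])
          (by simp [tick, hNi, hN25, hregN]; omega)
          (by simp [tick, hregi, hregN]; omega)
        refine ⟨t₁ + 3 + t₂ + 1, ?_, ?_⟩
        · rw [Nat.succ_mul]; omega
        · rw [Function.iterate_succ_apply]
          exact .loopStep (by omega) (.seq r₁ htick) r₂
    obtain ⟨t, ht, r⟩ := loop (s.reg N) 0 ((s.setReg i 0).setReg 25 (s.reg N))
      (fun r hr => by
        have hri : r ≠ i := fun e => hi (e ▸ hr)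
        have hr25 : r ≠ 25 := fun e => h25 (e ▸ hr)
        simp only [State.setReg_reg, hri, hr25, if_false]; exact hB r hr)
      (by simp [hi25]) (by simp [hNi, hN25]) (by simp)
    refine ⟨1 + (1 + t), ?_, ?_⟩
    · have := Nat.mul_le_mul_right (p.cost B + 4) (hB N hN)
      simp only [cost]; omega
    · have h2 := Runs.copy 25 N (s.setReg i 0)
      simp only [State.setReg_reg, hNi, if_false] at h2
      exact .seq (.const i 0 s) (.seq h2 r)
  | _ => exact ⟨1, le_rfl, by constructor⟩

/-- Induction along a loop: an invariant that holds at the start and is kept by every round holds at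
the end; the registers and arrays that the loop does not write to can be read off the initial
state. -/
theorem den_rep_induct {i N : ℕ} {p : Cmd} (s : State) (I : ℕ → State → Prop)
    (hi25 : i ≠ 25) (hpi : p.writesReg i = false)
    (h0 : I 0 ((s.setReg i 0).setReg 25 (s.reg N)))
    (hs : ∀ j < s.reg N, ∀ s' : State, s'.reg i = j →
      (∀ r, (rep i N p).writesReg r = false → s'.reg r = s.reg r) →
      (∀ a, (rep i N p).writesArr a = false → s'.arr a = s.arr a) →
      I j s' → I (j + 1) (tick i N (p.den s'))) :
    I (s.reg N) ((rep i N p).den s) := by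
  have aux : ∀ m ≤ s.reg N, ∀ s', s' = (fun s' => tick i N (p.den s'))^[m]
      ((s.setReg i 0).setReg 25 (s.reg N)) → s'.reg i = m ∧
      (∀ r, (rep i N p).writesReg r = false → s'.reg r = s.reg r) ∧
      (∀ a, (rep i N p).writesArr a = false → s'.arr a = s.arr a) ∧ I m s' := by
    intro m
    induction m with
    | zero =>
      rintro - s' rfl
      refine ⟨by simp [hi25], fun r hr => ?_, fun a _ => rfl, h0⟩
      simp only [writesReg, Bool.or_eq_false_iff, beq_eq_false_iff_ne] at hr
      simp [hr.1.1, hr.1.2]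
    | succ m ihm =>
      rintro hm s' rfl
      obtain ⟨h1, h2, h3, h4⟩ := ihm (by omega) _ rfl
      rw [Function.iterate_succ_apply']
      generalize (fun s' => tick i N (p.den s'))^[m]
        ((s.setReg i 0).setReg 25 (s.reg N)) = s' at h1 h2 h3 h4 ⊢
      refine ⟨?_, fun r hr => ?_, fun a ha => ?_, hs m (by omega) _ h1 h2 h3 h4⟩
      · simp only [tick, State.setReg_reg, hi25, if_true, if_false]
        rw [den_reg hpi, h1]
      · have hr' := hr
        simp only [writesReg, Bool.or_eq_false_iff, beq_eq_false_iff_ne] at hr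
        simp only [tick, State.setReg_reg, hr.1.1, hr.1.2, if_false]
        rw [den_reg hr.2, h2 r hr']
      · rw [← h3 a ha]
        exact den_arr (c := p) (by simpa only [writesArr] using ha) _
  exact (aux _ le_rfl _ rfl).2.2.2

/-! ### Derived commands -/

/-- Register `12` becomes nonzero if and only if registers `a` and `b` differ. -/
def differ (a b : ℕ) : Cmd := sub 12 a b ;; sub 25 b a ;; add 12 12 25

/-- If registers `a` and `b` are equal then `p`. -/
def ifEq (a b : ℕ) (p : Cmd) : Cmd := differ a b ;; ite 12 skip p

/-- If registers `a` and `b` differ then `p`. -/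
def ifNe (a b : ℕ) (p : Cmd) : Cmd := differ a b ;; ite 12 p skip

/-- Increase register `r` by one. -/
def incr (r : ℕ) : Cmd := const 25 1 ;; add r r 25

/-- For all `u, v < n`, with `u`, `v` and `u * n + v` in the registers `8`, `9` and `7`, do `p`. -/
def pairs (p : Cmd) : Cmd := const 7 0 ;; rep 8 0 (rep 9 0 (p ;; incr 7))

/-- Both truncated differences vanish exactly when the two numbers are equal. -/
theorem den_differ (a b : ℕ) (s : State) (ha : a ≠ 12) (hb : b ≠ 12) :
    ((differ a b).den s).reg 12 = 0 ↔ s.reg a = s.reg b := by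
  simp [differ, den, ha, hb]
  omega

theorem den_ifEq (a b : ℕ) (p : Cmd) (s : State) (ha : a ≠ 12) (hb : b ≠ 12) :
    (ifEq a b p).den s =
      if s.reg a = s.reg b then p.den ((differ a b).den s) else (differ a b).den s := by
  simp only [ifEq, den, den_differ a b s ha hb]

theorem den_ifNe (a b : ℕ) (p : Cmd) (s : State) (ha : a ≠ 12) (hb : b ≠ 12) :
    (ifNe a b p).den s =
      if s.reg a = s.reg b then (differ a b).den s else p.den ((differ a b).den s) := by
  simp only [ifNe, den, den_differ a b s ha hb]

@[simp] theorem differ_reg (a b r : ℕ) (s : State) (h : r ≠ 12) (h' : r ≠ 25) :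
    ((differ a b).den s).reg r = s.reg r := den_reg (by simp [differ, writesReg, h, h']) s

@[simp] theorem differ_arr (a b : ℕ) (s : State) : ((differ a b).den s).arr = s.arr := rfl

/-- The two nested inductions become one, indexed by the position `u * n + v` in the matrix. The
condition `hI` makes the invariant blind to the loop registers, which change between rounds. -/
theorem den_pairs_induct {p : Cmd} (s : State) (I : ℕ → State → Prop)
    (hp0 : p.writesReg 0 = false) (h7 : p.writesReg 7 = false) (h8 : p.writesReg 8 = false)
    (hp9 : p.writesReg 9 = false)
    (hI : ∀ m s s', (∀ r, r ≠ 7 → r ≠ 8 → r ≠ 9 → r ≠ 25 → s'.reg r = s.reg r) →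
      s'.arr = s.arr → I m s → I m s')
    (h0 : I 0 s)
    (hs : ∀ u < s.reg 0, ∀ v < s.reg 0, ∀ s' : State,
      s'.reg 8 = u → s'.reg 9 = v → s'.reg 7 = u * s.reg 0 + v →
      (∀ r, (pairs p).writesReg r = false → s'.reg r = s.reg r) →
      (∀ a, (pairs p).writesArr a = false → s'.arr a = s.arr a) →
      I (u * s.reg 0 + v) s' → I (u * s.reg 0 + v + 1) (p.den s')) :
    I (s.reg 0 * s.reg 0) ((pairs p).den s) := by
  set n := s.reg 0 with hn
  have hwr : ∀ r, (pairs p).writesReg r = false → r ≠ 7 ∧ r ≠ 8 ∧ r ≠ 9 ∧ r ≠ 25 ∧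
      p.writesReg r = false := by
    intro r hr
    simp only [pairs, incr, writesReg, Bool.or_eq_false_iff, beq_eq_false_iff_ne] at hr
    tauto
  have hwr' : ∀ r, (rep 8 0 (rep 9 0 (p ;; incr 7))).writesReg r = (pairs p).writesReg r := by
    intro r
    simp only [pairs, incr, writesReg]
    cases (r == 7) <;> simp
  have hwa' : ∀ r, (rep 8 0 (rep 9 0 (p ;; incr 7))).writesArr r = (pairs p).writesArr r := by
    intro r
    simp [pairs, incr, writesArr]
  have main := den_rep_induct (i := 8) (N := 0) (p := rep 9 0 (p ;; incr 7)) (s.setReg 7 0)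
    (fun u s' => s'.reg 7 = u * n ∧ I (u * n) s') (by decide)
    (by simp [incr, writesReg, h8])
    (by
      refine ⟨by simp, ?_⟩
      rw [Nat.zero_mul]
      refine hI 0 s _ ?_ rfl h0
      intro r h7 h8 h9 h25
      simp [h7, h8, h25])
    (by
      rintro u hu s' hu' hr' ha' ⟨h1, h2⟩
      have hu : u < n := by simpa using hu
      have hs0 : s'.reg 0 = n := by
        rw [hr' 0 (by rw [hwr']; simp [pairs, incr, writesReg, hp0])]; simp [hn]
      have inner := den_rep_induct (i := 9) (N := 0) (p := (p ;; incr 7)) s'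
        (fun v s' => s'.reg 7 = u * n + v ∧ I (u * n + v) s') (by decide)
        (by simp [incr, writesReg, hp9])
        (by
          refine ⟨by simp [h1], ?_⟩
          refine hI _ s' _ ?_ rfl (by simpa using h2)
          intro r h7 h8 h9 h25
          simp [h9, h25])
        (by
          rintro v hv s'' hv' hr'' ha'' ⟨h3, h4⟩
          have hv : v < n := by omega
          have key := hs u hu v hv s'' (by
              rw [hr'' 8 (by simp [incr, writesReg, h8]), hu']) hv' h3
            (fun r hr => by
              obtain ⟨e7, e8, e9, e25, hpr⟩ := hwr r hr
              rw [hr'' r (by simp [incr, writesReg, e7, e9, e25, hpr]),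
                hr' r (by rw [hwr', hr])]
              simp [e7])
            (fun a ha => by
              rw [ha'' a (by simpa [pairs, incr, writesArr] using ha), ha' a (by rw [hwa', ha])]
              rfl) h4
          have e7 : (p.den s'').reg 7 = u * n + v := by rw [den_reg h7, h3]
          refine ⟨by simp [tick, incr, den, e7, Nat.add_assoc], ?_⟩
          refine hI _ (p.den s'') _ ?_ rfl key
          intro r h7 h8 h9 h25
          simp [tick, incr, den, h7, h9, h25])
      rw [hs0] at inner
      refine ⟨by
        simp only [tick, State.setReg_reg]
        rw [if_neg (by decide), if_neg (by decide), if_neg (by decide), inner.1, Nat.succ_mul], ?_⟩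
      rw [Nat.succ_mul]
      refine hI _ ((rep 9 0 (p ;; incr 7)).den s') _ ?_ rfl inner.2
      intro r h7 h8 h9 h25
      simp [tick, h8, h25])
  have e : (s.setReg 7 0).reg 0 = n := by simp [hn]
  rw [e] at main
  exact main.2

end Cmd

end MaxDegContraction

namespace MaxDegContraction

/-! ### Labellings of the vertices

A partition of the vertices `0, …, n - 1` is given by a labelling `lab`: the classes are the sets of
vertices with the same label. The graph is given by a relation `E`. -/

/-- Some edge joins the classes with the labels `x` and `y`. -/
def Joined (n : ℕ) (E : ℕ → ℕ → Prop) (lab : ℕ → ℕ) (x y : ℕ) : Prop :=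
  ∃ u < n, ∃ v < n, E u v ∧ lab u = x ∧ lab v = y

/-- `u` and `v` get the same value under every function that is constant along the edges inside the
classes of `lab`. For `u` and `v` in the same class, this says that they are connected in the graph
induced on the class. -/
def Linked (n : ℕ) (E : ℕ → ℕ → Prop) (lab : ℕ → ℕ) (u v : ℕ) : Prop :=
  ∀ c : ℕ → ℕ, (∀ u < n, ∀ v < n, E u v → lab u = lab v → c u = c v) → c u = c v

/-- The class with label `x` induces a disconnected graph. -/
def Disconnected (n : ℕ) (E : ℕ → ℕ → Prop) (lab : ℕ → ℕ) (x : ℕ) : Prop :=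
  ∃ u < n, ∃ v < n, lab u = x ∧ lab v = x ∧ ¬ Linked n E lab u v

open Classical in
/-- The label `x`, followed by the labels below `m` of the classes that are adjacent to it. -/
noncomputable def nbrList (n : ℕ) (E : ℕ → ℕ → Prop) (lab : ℕ → ℕ) (x m : ℕ) : List ℕ :=
  x :: (List.range m).filter fun y => y ≠ x ∧ Joined n E lab x y

/-- The class with label `x` is disconnected or has more than `d` adjacent classes. -/
def Bad (n d : ℕ) (E : ℕ → ℕ → Prop) (lab : ℕ → ℕ) (x : ℕ) : Prop :=
  d + 1 < (nbrList n E lab x n).length ∨ Disconnected n E lab x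

/-- Replace the label `b` by `a`. -/
def relabel (n a b : ℕ) (lab : ℕ → ℕ) : ℕ → ℕ :=
  fun v => if v < n ∧ lab v = b then a else lab v

open Classical in
/-- If there is a bad class, merge the classes at positions `i` and `i + r + 1` of the list of the
first bad class and its neighbours, if the list is long enough. -/
noncomputable def mergeStep (n d : ℕ) (E : ℕ → ℕ → Prop) (i r : ℕ) (lab : ℕ → ℕ) : ℕ → ℕ :=
  if h : ∃ x, x < n ∧ Bad n d E lab x then
    let l := nbrList n E lab (Nat.find h) n
    if i + r + 1 < l.length then relabel n (l.getD i 0) (l.getD (i + r + 1) 0) lab else lab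
  else lab

/-- The labelling after `m` steps, when the choices are the entries of `g`. -/
noncomputable def labelling (n d K : ℕ) (E : ℕ → ℕ → Prop) (g : ℕ → ℕ) : ℕ → ℕ → ℕ
  | 0 => fun v => if v < n then v else 0
  | m + 1 => mergeStep n d E (g m) (g (m + K)) (labelling n d K E g m)

/-- The choices `g` lead to a labelling without bad classes. -/
def Accepts (n d K : ℕ) (E : ℕ → ℕ → Prop) (g : ℕ → ℕ) : Prop :=
  ∀ x < n, ¬ Bad n d E (labelling n d K E g K) x

theorem Linked.refl {n : ℕ} {E : ℕ → ℕ → Prop} {lab : ℕ → ℕ} (u : ℕ) : Linked n E lab u u :=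
  fun _ _ => rfl

theorem Linked.symm {n : ℕ} {E : ℕ → ℕ → Prop} {lab : ℕ → ℕ} {u v : ℕ}
    (h : Linked n E lab u v) : Linked n E lab v u :=
  fun c hc => (h c hc).symm

theorem Linked.trans {n : ℕ} {E : ℕ → ℕ → Prop} {lab : ℕ → ℕ} {u v w : ℕ}
    (h : Linked n E lab u v) (h' : Linked n E lab v w) : Linked n E lab u w :=
  fun c hc => (h c hc).trans (h' c hc)

theorem nbrList_succ_pos {n : ℕ} {E : ℕ → ℕ → Prop} {lab : ℕ → ℕ} {x m : ℕ}
    (h : m ≠ x ∧ Joined n E lab x m) :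
    nbrList n E lab x (m + 1) = nbrList n E lab x m ++ [m] := by
  simp [nbrList, List.range_succ, List.filter_append, h]

theorem nbrList_succ_neg {n : ℕ} {E : ℕ → ℕ → Prop} {lab : ℕ → ℕ} {x m : ℕ}
    (h : ¬ (m ≠ x ∧ Joined n E lab x m)) :
    nbrList n E lab x (m + 1) = nbrList n E lab x m := by
  simp only [nbrList, List.range_succ, List.filter_append]
  simp [h]

theorem pair_index_inj {n u v u' v' : ℕ} (hv : v < n) (hv' : v' < n)
    (h : u' * n + v' = u * n + v) : u' = u ∧ v' = v := by
  have h1 : (u' * n + v') / n = (u * n + v) / n := by rw [h]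
  rw [Nat.mul_comm, Nat.mul_comm u, Nat.mul_add_div (by omega), Nat.mul_add_div (by omega),
    Nat.div_eq_of_lt hv, Nat.div_eq_of_lt hv'] at h1
  have : u' = u := by omega
  subst this
  exact ⟨rfl, by omega⟩

theorem pair_index_lt {n u v : ℕ} (hu : u < n) (hv : v < n) : u * n + v < n * n := by
  calc u * n + v < u * n + n := by omega
    _ = (u + 1) * n := by ring
    _ ≤ n * n := Nat.mul_le_mul_right n hu

/-! ### The commands

Registers: `0` the number `n` of vertices, `1` the number `k`, `2` the degree bound `d`, `3` the
number of merging steps, `4` twice that number, `5` the flag of the main loop, `6` the answer,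
`7`, `8`, `9` for loops over pairs of vertices, `10`, `11`, `12` temporary values, `13` a flag, `14`
and `15` labels to be merged, `16` a vertex, `17` and `18` labels, `19` the length of the list in
array `3`, `20` whether a bad class has been found, `21` the number of the step, `22` and `23`
positions in the list, `24` the carry.

Arrays: `0` the adjacency matrix, `1` the labelling, `2` the components of the classes, `3` a list
of labels, `4` the choices. -/

/-- The edge relation stored in array `0`. -/
def State.edge (s : State) (u v : ℕ) : Prop := s.arr 0 (u * s.reg 0 + v) ≠ 0

theorem State.edge_congr {s s' : State} (h : s'.reg 0 = s.reg 0) (h' : s'.arr 0 = s.arr 0) :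
    s'.edge = s.edge := by
  funext u v
  simp only [State.edge, h, h']

namespace Cmd

/-- In array `α`, replace the label in register `15` by the label in register `14`. -/
def merge (α : ℕ) : Cmd := rep 16 0 (load 11 α 16 ;; ifEq 11 15 (store α 16 14))

/-- Label every vertex by itself in array `α`. -/
def initLabels (α : ℕ) : Cmd := rep 16 0 (store α 16 16)

/-- Compute the connected components of the classes into array `2`. -/
def components : Cmd :=
  initLabels 2 ;; pairs (load 10 0 7 ;; ite 10 (load 11 1 8 ;; load 10 1 9 ;;
    ifEq 11 10 (load 14 2 8 ;; load 15 2 9 ;; merge 2)) skip)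

/-- Set register `13` according to whether the classes in registers `17` and `18` are joined. -/
def testJoined : Cmd :=
  const 13 0 ;; pairs (load 10 0 7 ;; ite 10 (load 11 1 8 ;;
    ifEq 11 17 (load 11 1 9 ;; ifEq 11 18 (const 13 1))) skip)

/-- List the class in register `17` and its neighbours in array `3`. -/
def listNbrs : Cmd :=
  const 22 0 ;; store 3 22 17 ;; const 19 1 ;;
    rep 18 0 (ifNe 18 17 (testJoined ;; ite 13 (store 3 19 18 ;; incr 19) skip))

/-- Set register `13` according to whether the class in register `17` is disconnected. -/
def testDisconnected : Cmd :=
  const 13 0 ;; pairs (load 11 1 8 ;; ifEq 11 17 (load 11 1 9 ;;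
    ifEq 11 17 (load 11 2 8 ;; load 10 2 9 ;; ifNe 11 10 (const 13 1))))

/-- Find the first bad class. -/
def findBad : Cmd :=
  components ;; const 20 0 ;; rep 17 0 (ite 20 skip (listNbrs ;; testDisconnected ;;
    sub 10 19 2 ;; const 11 1 ;; sub 10 10 11 ;; add 10 10 13 ;; ite 10 (const 20 1) skip))

/-- One merging step. -/
def step : Cmd :=
  findBad ;; ite 20 (load 22 4 21 ;; add 23 21 3 ;; load 23 4 23 ;; add 23 22 23 ;; incr 23 ;;
    sub 10 19 23 ;; ite 10 (load 14 3 22 ;; load 15 3 23 ;; merge 1) skip) skip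

/-- All merging steps, and the final test. -/
def simulate : Cmd :=
  initLabels 1 ;; rep 21 3 step ;; findBad ;; ite 20 skip (const 6 1)

/-- Pass to the next sequence of choices. -/
def nextChoices : Cmd :=
  const 24 1 ;; rep 21 4 (ite 24 (load 10 4 21 ;; differ 10 2 ;;
    ite 12 (incr 10 ;; store 4 21 10 ;; const 24 0) (const 10 0 ;; store 4 21 10)) skip)

/-- The body of the main loop. -/
def round : Cmd := simulate ;; nextChoices ;; const 10 1 ;; sub 5 10 24

/-! ### Their meaning -/

theorem den_merge (α : ℕ) (s : State) :
    ((merge α).den s).arr α = relabel (s.reg 0) (s.reg 14) (s.reg 15) (s.arr α) := by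
  refine den_rep_induct s
    (fun j s' => s'.arr α = relabel j (s.reg 14) (s.reg 15) (s.arr α)) (by decide) rfl ?_ ?_
  · funext v
    simp [relabel]
  · intro j hj s' hi hr ha I
    have e : s.arr α j = s'.arr α j := by simp [I, relabel]
    have h15 := hr 15 rfl
    have h14 := hr 14 rfl
    funext v
    simp only [tick, State.setReg_arr, den_seq, den_load]
    rw [den_ifEq _ _ _ _ (by decide) (by decide)]
    by_cases h : s'.arr α j = s.reg 15
    · simp [den, hi, h, h15, h14, Function.update_apply, I]
      by_cases hv : v = j
      · simp [hv, relabel, e, h]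
      · have : v < j + 1 ↔ v < j := by omega
        simp [hv, relabel, this]
    · rw [if_neg (by simpa [hi, h15] using h)]
      simp [I]
      by_cases hv : v = j
      · simp [hv, relabel, e, h]
      · have : v < j + 1 ↔ v < j := by omega
        simp [relabel, this]

theorem den_initLabels (α : ℕ) (s : State) :
    ((initLabels α).den s).arr α = fun v => if v < s.reg 0 then v else s.arr α v := by
  refine den_rep_induct s
    (fun j s' => s'.arr α = fun v => if v < j then v else s.arr α v) (by decide) rfl ?_ ?_
  · funext v
    simp
  · intro j hj s' hi hr ha I
    funext v
    simp only [tick, State.setReg_arr, den_store]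
    simp only [State.setArr_arr, if_true, hi, Function.update_apply, I]
    by_cases hv : v = j
    · simp [hv]
    · have : v < j + 1 ↔ v < j := by omega
      rw [if_neg hv, if_congr this rfl rfl]

/-- Labels are merged along each edge inside a class. Throughout, equal labels imply linked
vertices, and the edges already processed have equally labelled ends. -/
theorem den_components (s : State) {u v : ℕ} (hu : u < s.reg 0) (hv : v < s.reg 0) :
    (components.den s).arr 2 u = (components.den s).arr 2 v ↔
      Linked (s.reg 0) s.edge (s.arr 1) u v := by
  set s₁ := (initLabels 2).den s with hs₁
  have e0 : s₁.reg 0 = s.reg 0 := den_reg rfl s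
  have ea0 : s₁.arr 0 = s.arr 0 := den_arr rfl s
  have ea1 : s₁.arr 1 = s.arr 1 := den_arr rfl s
  have ea2 := den_initLabels 2 s
  rw [← hs₁] at ea2
  set n := s.reg 0 with hn
  have key := den_pairs_induct s₁
    (p := load 10 0 7 ;; ite 10 (load 11 1 8 ;; load 10 1 9 ;;
      ifEq 11 10 (load 14 2 8 ;; load 15 2 9 ;; merge 2)) skip)
    (fun m s' =>
      (∀ u < n, ∀ v < n, s'.arr 2 u = s'.arr 2 v → Linked n s.edge (s.arr 1) u v) ∧
      (∀ u < n, ∀ v < n, u * n + v < m → s.edge u v → s.arr 1 u = s.arr 1 v →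
        s'.arr 2 u = s'.arr 2 v)) rfl rfl rfl rfl ?_ ?_ ?_
  · rw [e0] at key
    obtain ⟨k1, k2⟩ := key
    -- The final content of array `2` is constant along all edges inside classes, so it is itself an
    -- admissible test function in `Linked`.
    refine ⟨k1 u hu v hv, fun h => h _ fun u hu v hv => k2 u hu v hv (pair_index_lt hu hv)⟩
  · intro m s s' _ ha h
    rw [ha]
    exact h
  · refine ⟨fun u hu v hv h => ?_, fun u _ v _ h => absurd h (by omega)⟩
    rw [ea2] at h
    simp only [hu, hv, if_true] at h
    rw [h]
    exact Linked.refl v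
  · intro u hu v hv s' h8 h9 h7 hr ha ⟨I1, I2⟩
    rw [e0] at hu hv h7 I2 ⊢
    have hs0 : s'.reg 0 = n := by rw [hr 0 rfl, e0]
    have ha0 : s'.arr 0 = s.arr 0 := by rw [ha 0 rfl, ea0]
    have ha1 : s'.arr 1 = s.arr 1 := by rw [ha 1 rfl, ea1]
    have step_ge : ∀ (P : ℕ → ℕ → Prop), (∀ a < n, ∀ b < n, a * n + b < u * n + v → P a b) →
        P u v → ∀ a < n, ∀ b < n, a * n + b < u * n + v + 1 → P a b := by
      intro P h1 h2 a ha b hb hab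
      rcases Nat.lt_succ_iff_lt_or_eq.mp hab with h | h
      · exact h1 a ha b hb h
      · obtain ⟨rfl, rfl⟩ := pair_index_inj hv hb h
        exact h2
    by_cases he : s.edge u v
    · have he' : s'.arr 0 (u * n + v) ≠ 0 := by rw [ha0]; exact he
      by_cases hl : s.arr 1 u = s.arr 1 v
      · have e2 : (den (load 10 0 7 ;; ite 10 (load 11 1 8 ;; load 10 1 9 ;;
            ifEq 11 10 (load 14 2 8 ;; load 15 2 9 ;; merge 2)) skip) s').arr 2 =
            relabel n (s'.arr 2 u) (s'.arr 2 v) (s'.arr 2) := by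
          simp only [den_seq, den_load]
          rw [den_ite_of_ne (by simpa [h7] using he')]
          simp only [den_seq, den_load]
          rw [den_ifEq _ _ _ _ (by decide) (by decide),
            if_pos (by simp [h8, h9, ha1, hl])]
          simp only [den_seq, den_load]
          rw [den_merge]
          simp [h8, h9, hs0]
        rw [e2]
        have huv : Linked n s.edge (s.arr 1) u v := fun c hc => hc u hu v hv he hl
        refine ⟨fun a ha b hb hab => ?_, step_ge _ (fun a ha b hb hab hE hL => ?_) fun _ _ => ?_⟩
        · simp only [relabel, ha, hb, true_and] at hab
          split_ifs at hab with h1 h2 h2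
          · exact (I1 a ha v hv h1).trans (I1 b hb v hv h2).symm
          · exact (I1 a ha v hv h1).trans (huv.symm.trans (I1 u hu b hb hab))
          · exact (I1 a ha u hu hab).trans (huv.trans (I1 v hv b hb h2.symm))
          · exact I1 a ha b hb hab
        · have := I2 a ha b hb hab hE hL
          simp only [relabel, ha, hb, true_and, this]
        · simp only [relabel, hu, hv, true_and, if_true]
          split_ifs <;> rfl
      · have e2 : (den (load 10 0 7 ;; ite 10 (load 11 1 8 ;; load 10 1 9 ;;
            ifEq 11 10 (load 14 2 8 ;; load 15 2 9 ;; merge 2)) skip) s').arr 2 = s'.arr 2 := by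
          simp only [den_seq, den_load]
          rw [den_ite_of_ne (by simpa [h7] using he')]
          simp only [den_seq, den_load]
          rw [den_ifEq _ _ _ _ (by decide) (by decide),
            if_neg (by simp [h8, h9, ha1, hl])]
          simp
        rw [e2]
        exact ⟨I1, step_ge _ I2 fun _ h => absurd h hl⟩
    · have he' : s'.arr 0 (u * n + v) = 0 := by rw [ha0]; exact not_not.mp he
      have e2 : (den (load 10 0 7 ;; ite 10 (load 11 1 8 ;; load 10 1 9 ;;
          ifEq 11 10 (load 14 2 8 ;; load 15 2 9 ;; merge 2)) skip) s').arr 2 = s'.arr 2 := by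
        simp only [den_seq, den_load]
        rw [den_ite_of_eq (by simpa [h7] using he')]
        simp
      rw [e2]
      exact ⟨I1, step_ge _ I2 fun h => absurd h he⟩

/-- A loop over all pairs of vertices that sets register `13` at the pairs with a certain property
searches for a pair with this property. -/
theorem den_search {p : Cmd} (s : State) (P : ℕ → ℕ → Prop)
    (hp0 : p.writesReg 0 = false) (h7 : p.writesReg 7 = false) (h8 : p.writesReg 8 = false)
    (hp9 : p.writesReg 9 = false)
    (hp : ∀ u < s.reg 0, ∀ v < s.reg 0, ∀ s' : State,
      s'.reg 8 = u → s'.reg 9 = v → s'.reg 7 = u * s.reg 0 + v →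
      (∀ r, r ≠ 13 → (pairs p).writesReg r = false → s'.reg r = s.reg r) →
      (∀ a, (pairs p).writesArr a = false → s'.arr a = s.arr a) →
      ((p.den s').reg 13 ≠ 0 ↔ s'.reg 13 ≠ 0 ∨ P u v)) :
    (den (const 13 0 ;; pairs p) s).reg 13 ≠ 0 ↔ ∃ u < s.reg 0, ∃ v < s.reg 0, P u v := by
  have key := den_pairs_induct (s.setReg 13 0) (p := p)
    (fun m s' => s'.reg 13 ≠ 0 ↔ ∃ u < s.reg 0, ∃ v < s.reg 0, u * s.reg 0 + v < m ∧ P u v)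
    hp0 h7 h8 hp9 ?_ ?_ ?_
  · refine key.trans ⟨fun ⟨u, hu, v, hv, _, h⟩ => ⟨u, hu, v, hv, h⟩,
      fun ⟨u, hu, v, hv, h⟩ => ⟨u, hu, v, hv, ?_, h⟩⟩
    simpa using pair_index_lt hu hv
  · intro m s₁ s₂ h _ h'
    rw [h 13 (by decide) (by decide) (by decide) (by decide)]
    exact h'
  · simp
  · simp only [State.setReg_reg, OfNat.zero_ne_ofNat, if_false]
    intro u hu v hv s' e8 e9 e7 hr ha I
    rw [hp u hu v hv s' e8 e9 e7 (fun r h13 hr' => by rw [hr r hr', if_neg h13]) ha, I]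
    constructor
    · rintro (⟨a, ha, b, hb, hab, h⟩ | h)
      · exact ⟨a, ha, b, hb, by omega, h⟩
      · exact ⟨u, hu, v, hv, by omega, h⟩
    · rintro ⟨a, ha, b, hb, hab, h⟩
      rcases Nat.lt_succ_iff_lt_or_eq.mp hab with h' | h'
      · exact Or.inl ⟨a, ha, b, hb, h', h⟩
      · obtain ⟨rfl, rfl⟩ := pair_index_inj hv hb h'
        exact Or.inr h

theorem den_testJoined (s : State) : (testJoined.den s).reg 13 ≠ 0 ↔
    Joined (s.reg 0) s.edge (s.arr 1) (s.reg 17) (s.reg 18) := by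
  refine den_search s (fun u v => s.edge u v ∧ s.arr 1 u = s.reg 17 ∧ s.arr 1 v = s.reg 18)
    rfl rfl rfl rfl ?_
  intro u hu v hv s' h8 h9 h7 hr ha
  have h17 := hr 17 (by decide) rfl
  have h18 := hr 18 (by decide) rfl
  have a0 := ha 0 rfl
  have a1 := ha 1 rfl
  simp only [den_seq, den_load]
  by_cases he : s.edge u v
  · have he' : s'.arr 0 (u * s.reg 0 + v) ≠ 0 := by rw [a0]; exact he
    rw [den_ite_of_ne (by simpa [h7] using he')]
    simp only [den_seq, den_load]
    rw [den_ifEq _ _ _ _ (by decide) (by decide)]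
    by_cases hu' : s.arr 1 u = s.reg 17
    · rw [if_pos (by simpa [h8, a1, h17] using hu')]
      simp only [den_seq, den_load]
      rw [den_ifEq _ _ _ _ (by decide) (by decide)]
      by_cases hv' : s.arr 1 v = s.reg 18
      · rw [if_pos (by simpa [h9, a1, h18] using hv')]
        simp [he, hu', hv']
      · rw [if_neg (by simpa [h9, a1, h18] using hv')]
        simp [hv']
    · rw [if_neg (by simpa [h8, a1, h17] using hu')]
      simp [hu']
  · have he' : s'.arr 0 (u * s.reg 0 + v) = 0 := by rw [a0]; exact not_not.mp he
    rw [den_ite_of_eq (by simpa [h7] using he')]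
    simp [he]

theorem den_testDisconnected (s : State)
    (h : ∀ u < s.reg 0, ∀ v < s.reg 0, s.arr 2 u = s.arr 2 v ↔
      Linked (s.reg 0) s.edge (s.arr 1) u v) :
    (testDisconnected.den s).reg 13 ≠ 0 ↔
      Disconnected (s.reg 0) s.edge (s.arr 1) (s.reg 17) := by
  refine den_search s (fun u v => s.arr 1 u = s.reg 17 ∧ s.arr 1 v = s.reg 17 ∧
    ¬ Linked (s.reg 0) s.edge (s.arr 1) u v) rfl rfl rfl rfl ?_
  intro u hu v hv s' h8 h9 h7 hr ha
  have h17 := hr 17 (by decide) rfl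
  have a1 := ha 1 rfl
  have a2 := ha 2 rfl
  have huv := h u hu v hv
  simp only [den_seq, den_load]
  rw [den_ifEq _ _ _ _ (by decide) (by decide)]
  by_cases hu' : s.arr 1 u = s.reg 17
  · rw [if_pos (by simpa [h8, a1, h17] using hu')]
    simp only [den_seq, den_load]
    rw [den_ifEq _ _ _ _ (by decide) (by decide)]
    by_cases hv' : s.arr 1 v = s.reg 17
    · rw [if_pos (by simpa [h9, a1, h17] using hv')]
      simp only [den_seq, den_load]
      rw [den_ifNe _ _ _ _ (by decide) (by decide)]
      by_cases hc : s.arr 2 u = s.arr 2 v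
      · rw [if_pos (by simpa [h8, h9, a2] using hc)]
        simp [huv.1 hc]
      · rw [if_neg (by simpa [h8, h9, a2] using hc)]
        simp [hu', hv', mt huv.2 hc]
    · rw [if_neg (by simpa [h9, a1, h17] using hv')]
      simp [hv']
  · rw [if_neg (by simpa [h8, a1, h17] using hu')]
    simp [hu']

theorem den_listNbrs (s : State) :
    (listNbrs.den s).reg 19 = (nbrList (s.reg 0) s.edge (s.arr 1) (s.reg 17) (s.reg 0)).length ∧
    ∀ i < (nbrList (s.reg 0) s.edge (s.arr 1) (s.reg 17) (s.reg 0)).length,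
      (listNbrs.den s).arr 3 i =
        (nbrList (s.reg 0) s.edge (s.arr 1) (s.reg 17) (s.reg 0)).getD i 0 := by
  set n := s.reg 0 with hn
  set s₁ := (den (const 22 0 ;; store 3 22 17 ;; const 19 1) s) with hs₁
  have e0 : s₁.reg 0 = n := den_reg rfl s
  have e17 : s₁.reg 17 = s.reg 17 := den_reg rfl s
  have ea0 : s₁.arr 0 = s.arr 0 := den_arr rfl s
  have ea1 : s₁.arr 1 = s.arr 1 := den_arr rfl s
  have key := den_rep_induct s₁ (i := 18) (N := 0)
    (p := ifNe 18 17 (testJoined ;; ite 13 (store 3 19 18 ;; incr 19) skip))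
    (fun j s' => s'.reg 19 = (nbrList n s.edge (s.arr 1) (s.reg 17) j).length ∧
      ∀ i < (nbrList n s.edge (s.arr 1) (s.reg 17) j).length,
        s'.arr 3 i = (nbrList n s.edge (s.arr 1) (s.reg 17) j).getD i 0) (by decide) rfl ?_ ?_
  · rw [e0] at key
    exact key
  · refine ⟨by simp [hs₁, nbrList], fun i hi => ?_⟩
    have hi : i = 0 := by simpa [nbrList] using hi
    simp [hi, hs₁, nbrList]
  · intro j hj s' h18 hr ha ⟨I1, I2⟩
    rw [e0] at hj
    have h0 : s'.reg 0 = n := by rw [hr 0 rfl, e0]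
    have h17 : s'.reg 17 = s.reg 17 := by rw [hr 17 rfl, e17]
    have a0 : s'.arr 0 = s.arr 0 := by rw [ha 0 rfl, ea0]
    have a1 : s'.arr 1 = s.arr 1 := by rw [ha 1 rfl, ea1]
    rw [den_ifNe _ _ _ _ (by decide) (by decide)]
    by_cases hjx : j = s.reg 17
    · rw [if_pos (by rw [h18, h17, hjx]), nbrList_succ_neg (by simp [hjx])]
      simpa [tick] using ⟨I1, I2⟩
    · rw [if_neg (by rw [h18, h17]; exact hjx)]
      set s₂ := (differ 18 17).den s' with hs₂
      have hJ := den_testJoined s₂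
      have t0 : s₂.reg 0 = n := by rw [hs₂, den_reg rfl, h0]
      rw [State.edge_congr (s' := s₂) (s := s) t0 (by rw [hs₂, den_arr rfl, a0]), t0,
        show s₂.reg 17 = s.reg 17 by rw [hs₂, den_reg rfl, h17],
        show s₂.reg 18 = j by rw [hs₂, den_reg rfl, h18],
        show s₂.arr 1 = s.arr 1 by rw [hs₂, den_arr rfl, a1]] at hJ
      have t19 : (testJoined.den s₂).reg 19 = (nbrList n s.edge (s.arr 1) (s.reg 17) j).length := by
        rw [den_reg rfl, hs₂, den_reg rfl, I1]
      have t18 : (testJoined.den s₂).reg 18 = j := by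
        rw [den_reg rfl, hs₂, den_reg rfl, h18]
      have t3 : (testJoined.den s₂).arr 3 = s'.arr 3 := by
        rw [den_arr rfl, hs₂, den_arr rfl]
      rw [den_seq]
      by_cases hj' : Joined n s.edge (s.arr 1) (s.reg 17) j
      · rw [den_ite_of_ne (hJ.2 hj'), nbrList_succ_pos ⟨hjx, hj'⟩]
        refine ⟨by simp [tick, incr, t19], fun i hi => ?_⟩
        simp only [tick, incr, den_seq, den_store, den_const, den_add, State.setReg_arr,
          State.setArr_arr, if_true, t19, t18, t3, Function.update_apply]
        split_ifs with h
        · simp [h]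
        · have hi : i < (nbrList n s.edge (s.arr 1) (s.reg 17) j).length := by
            simp at hi; omega
          rw [I2 i hi, List.getD_append _ _ _ _ hi]
      · rw [den_ite_of_eq (not_not.mp (mt hJ.1 hj')), nbrList_succ_neg (by simp [hj'])]
        simpa [tick, t19, t3] using I2

end Cmd

end MaxDegContraction

namespace MaxDegContraction

/-! ### The search for a bad class, the merging steps and the counter of choices. -/

theorem mergeStep_of_first {n d : ℕ} {E : ℕ → ℕ → Prop} {i r : ℕ} {lab : ℕ → ℕ} {x : ℕ}
    (hx : x < n) (hbad : Bad n d E lab x) (hfirst : ∀ y < x, ¬ Bad n d E lab y) :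
    mergeStep n d E i r lab =
      if i + r + 1 < (nbrList n E lab x n).length then
        relabel n ((nbrList n E lab x n).getD i 0) ((nbrList n E lab x n).getD (i + r + 1) 0) lab
      else lab := by
  classical
  have h : ∃ x, x < n ∧ Bad n d E lab x := ⟨x, hx, hbad⟩
  have e : Nat.find h = x := (Nat.find_eq_iff h).2 ⟨⟨hx, hbad⟩, fun y hy hy' => hfirst y hy hy'.2⟩
  rw [mergeStep, dif_pos h]
  simp only [e]

theorem mergeStep_of_forall_not {n d : ℕ} {E : ℕ → ℕ → Prop} {i r : ℕ} {lab : ℕ → ℕ}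
    (h : ∀ x < n, ¬ Bad n d E lab x) : mergeStep n d E i r lab = lab :=
  dif_neg fun ⟨x, hx, hb⟩ => h x hx hb

theorem relabel_of_ge {n a b v : ℕ} {lab : ℕ → ℕ} (hv : n ≤ v) : relabel n a b lab v = lab v :=
  if_neg fun h => absurd h.1 (by omega)

theorem mergeStep_of_ge {n d : ℕ} {E : ℕ → ℕ → Prop} {i r v : ℕ} {lab : ℕ → ℕ} (hv : n ≤ v) :
    mergeStep n d E i r lab v = lab v := by
  unfold mergeStep
  split_ifs
  · simp only
    split_ifs
    · exact relabel_of_ge hv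
    · rfl
  · rfl

/-- The default value `0` is also the content of array `1` beyond `n`, so that array and labelling
agree as functions on all of `ℕ`. -/
theorem labelling_of_ge {n d K : ℕ} {E : ℕ → ℕ → Prop} {g : ℕ → ℕ} {m v : ℕ} (hv : n ≤ v) :
    labelling n d K E g m v = 0 := by
  induction m with
  | zero => exact if_neg (by omega)
  | succ m ih => rw [labelling, mergeStep_of_ge hv, ih]

namespace Cmd

/-- The number tested is `(length - d - 1)` plus the disconnectedness flag, which is nonzero exactly
for bad classes. Once one is found the remaining rounds do nothing, so its list survives in array
`3`. Labels that no vertex carries are never bad, so testing all `x < n` is harmless. -/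
theorem den_findBad (s : State) :
    ((findBad.den s).reg 20 = 0 → ∀ x < s.reg 0, ¬ Bad (s.reg 0) (s.reg 2) s.edge (s.arr 1) x) ∧
    ((findBad.den s).reg 20 ≠ 0 → ∃ x < s.reg 0, Bad (s.reg 0) (s.reg 2) s.edge (s.arr 1) x ∧
      (∀ y < x, ¬ Bad (s.reg 0) (s.reg 2) s.edge (s.arr 1) y) ∧
      (findBad.den s).reg 19 = (nbrList (s.reg 0) s.edge (s.arr 1) x (s.reg 0)).length ∧
      ∀ i < (nbrList (s.reg 0) s.edge (s.arr 1) x (s.reg 0)).length,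
        (findBad.den s).arr 3 i = (nbrList (s.reg 0) s.edge (s.arr 1) x (s.reg 0)).getD i 0) := by
  set n := s.reg 0 with hn
  set d := s.reg 2 with hd
  set s₁ := (den (components ;; const 20 0) s) with hs₁
  have e0 : s₁.reg 0 = n := den_reg rfl s
  have e2 : s₁.reg 2 = d := den_reg rfl s
  have ea0 : s₁.arr 0 = s.arr 0 := den_arr rfl s
  have ea1 : s₁.arr 1 = s.arr 1 := den_arr rfl s
  have ea2 : ∀ u < n, ∀ v < n, s₁.arr 2 u = s₁.arr 2 v ↔ Linked n s.edge (s.arr 1) u v :=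
    fun u hu v hv => den_components s hu hv
  have key := den_rep_induct s₁ (i := 17) (N := 0)
    (p := ite 20 skip (listNbrs ;; testDisconnected ;;
      sub 10 19 2 ;; const 11 1 ;; sub 10 10 11 ;; add 10 10 13 ;; ite 10 (const 20 1) skip))
    (fun j s' => (s'.reg 20 = 0 → ∀ x < j, ¬ Bad n d s.edge (s.arr 1) x) ∧
      (s'.reg 20 ≠ 0 → ∃ x < j, Bad n d s.edge (s.arr 1) x ∧
        (∀ y < x, ¬ Bad n d s.edge (s.arr 1) y) ∧
        s'.reg 19 = (nbrList n s.edge (s.arr 1) x n).length ∧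
        ∀ i < (nbrList n s.edge (s.arr 1) x n).length,
          s'.arr 3 i = (nbrList n s.edge (s.arr 1) x n).getD i 0)) (by decide) rfl ?_ ?_
  · rw [e0] at key
    exact key
  · exact ⟨fun _ x hx => absurd hx (by omega), fun h => absurd (by simp [hs₁]) h⟩
  · intro j hj s' h17 hr ha ⟨I1, I2⟩
    rw [e0] at hj
    have h0 : s'.reg 0 = n := by rw [hr 0 rfl, e0]
    have h2 : s'.reg 2 = d := by rw [hr 2 rfl, e2]
    have a0 : s'.arr 0 = s.arr 0 := by rw [ha 0 rfl, ea0]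
    have a1 : s'.arr 1 = s.arr 1 := by rw [ha 1 rfl, ea1]
    have a2 : s'.arr 2 = s₁.arr 2 := ha 2 rfl
    have eE : s'.edge = s.edge := State.edge_congr h0 a0
    by_cases h20 : s'.reg 20 = 0
    · rw [den_ite_of_eq h20]
      have hl := den_listNbrs s'
      rw [h0, eE, a1, h17] at hl
      obtain ⟨hl1, hl2⟩ := hl
      set s₂ := listNbrs.den s' with hs₂
      have f0 : s₂.reg 0 = n := by rw [hs₂, den_reg rfl, h0]
      have f2 : s₂.reg 2 = d := by rw [hs₂, den_reg rfl, h2]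
      have f17 : s₂.reg 17 = j := by rw [hs₂, den_reg rfl, h17]
      have f20 : s₂.reg 20 = 0 := by rw [hs₂, den_reg rfl, h20]
      have b1 : s₂.arr 1 = s.arr 1 := by rw [hs₂, den_arr rfl, a1]
      have b2 : s₂.arr 2 = s₁.arr 2 := by rw [hs₂, den_arr rfl, a2]
      have fE : s₂.edge = s.edge := State.edge_congr f0 (by rw [hs₂, den_arr rfl, a0])
      have hD := den_testDisconnected s₂ (by rw [f0, fE, b1, b2]; exact ea2)
      rw [f0, fE, b1, f17] at hD
      simp only [den_seq]
      rw [← hs₂]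
      set s₃ := testDisconnected.den s₂ with hs₃
      have g19 : s₃.reg 19 = s₂.reg 19 := by rw [hs₃, den_reg rfl]
      have g2 : s₃.reg 2 = d := by rw [hs₃, den_reg rfl, f2]
      have g20 : s₃.reg 20 = 0 := by rw [hs₃, den_reg rfl, f20]
      have c3 : s₃.arr 3 = s₂.arr 3 := by rw [hs₃, den_arr rfl]
      by_cases hbad : Bad n d s.edge (s.arr 1) j
      · rw [den_ite_of_ne (by
          rcases hbad with h | h
          · simp [g19, g2, hl1]
            omega
          · have := hD.2 h
            simp
            omega)]
        refine ⟨fun h => absurd h (by simp [tick]), fun _ => ⟨j, by omega, hbad, I1 h20, ?_⟩⟩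
        simp only [tick, den_const, den_add, den_sub, State.setReg_reg, State.setReg_arr, c3]
        refine ⟨?_, hl2⟩
        simpa [g19] using hl1
      · have hnb : ¬ d + 1 < s₂.reg 19 := fun h => hbad (Or.inl (by rw [← hl1]; exact h))
        have hnd : s₃.reg 13 = 0 := not_not.mp (mt hD.1 fun h => hbad (Or.inr h))
        rw [den_ite_of_eq (by simp [g19, g2, hnd]; omega)]
        refine ⟨fun _ x hx => ?_, fun h => absurd (by simp [tick, g20]) h⟩
        rcases Nat.lt_succ_iff_lt_or_eq.mp hx with h | rfl
        · exact I1 h20 x h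
        · exact hbad
    · rw [den_ite_of_ne h20]
      refine ⟨fun h => absurd (by simpa [tick] using h) h20, fun _ => ?_⟩
      obtain ⟨x, hx, h⟩ := I2 h20
      refine ⟨x, by omega, ?_⟩
      simpa [tick] using h

theorem den_step (s : State) : (step.den s).arr 1 =
    mergeStep (s.reg 0) (s.reg 2) s.edge (s.arr 4 (s.reg 21)) (s.arr 4 (s.reg 21 + s.reg 3))
      (s.arr 1) := by
  obtain ⟨h1, h2⟩ := den_findBad s
  simp only [step, den_seq]
  set s₁ := findBad.den s with hs₁
  have e0 : s₁.reg 0 = s.reg 0 := by rw [hs₁, den_reg rfl]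
  have e3 : s₁.reg 3 = s.reg 3 := by rw [hs₁, den_reg rfl]
  have e21 : s₁.reg 21 = s.reg 21 := by rw [hs₁, den_reg rfl]
  have a4 : s₁.arr 4 = s.arr 4 := by rw [hs₁, den_arr rfl]
  have a1 : s₁.arr 1 = s.arr 1 := by rw [hs₁, den_arr rfl]
  by_cases h : s₁.reg 20 = 0
  · rw [den_ite_of_eq h, mergeStep_of_forall_not (h1 h), den_skip, a1]
  · obtain ⟨x, hx, hbad, hfirst, h19, h3⟩ := h2 h
    rw [den_ite_of_ne h, mergeStep_of_first hx hbad hfirst]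
    simp only [den_seq, incr]
    split_ifs with hlt
    · rw [den_ite_of_ne (by simp [h19, e3, e21, a4]; omega)]
      simp only [den_seq]
      rw [den_merge]
      simp [e0, e3, e21, a1, a4, h3 _ hlt, h3 (s.arr 4 (s.reg 21)) (by omega)]
    · rw [den_ite_of_eq (by simp [h19, e3, e21, a4]; omega)]
      simp [a1]

/-- Register `6` is set on acceptance and otherwise left alone, so over all rounds it accumulates a
disjunction. -/
theorem den_simulate (s : State) (h1 : ∀ v, s.reg 0 ≤ v → s.arr 1 v = 0) :
    (∀ v, s.reg 0 ≤ v → (simulate.den s).arr 1 v = 0) ∧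
    (Accepts (s.reg 0) (s.reg 2) (s.reg 3) s.edge (s.arr 4) → (simulate.den s).reg 6 = 1) ∧
    (¬ Accepts (s.reg 0) (s.reg 2) (s.reg 3) s.edge (s.arr 4) →
      (simulate.den s).reg 6 = s.reg 6) := by
  set n := s.reg 0 with hn
  set s₁ := (initLabels 1).den s with hs₁
  have e0 : s₁.reg 0 = n := den_reg rfl s
  have e2 : s₁.reg 2 = s.reg 2 := den_reg rfl s
  have e3 : s₁.reg 3 = s.reg 3 := den_reg rfl s
  have ea0 : s₁.arr 0 = s.arr 0 := den_arr rfl s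
  have ea4 : s₁.arr 4 = s.arr 4 := den_arr rfl s
  have key := den_rep_induct s₁ (i := 21) (N := 3) (p := step)
    (fun j s' => s'.arr 1 = labelling n (s.reg 2) (s.reg 3) s.edge (s.arr 4) j)
    (by decide) rfl ?_ ?_
  · rw [e3] at key
    set s₂ := (rep 21 3 step).den s₁ with hs₂
    have f0 : s₂.reg 0 = n := by rw [hs₂, den_reg rfl, e0]
    have f2 : s₂.reg 2 = s.reg 2 := by rw [hs₂, den_reg rfl, e2]
    have f6 : (findBad.den s₂).reg 6 = s.reg 6 := by
      rw [den_reg rfl, hs₂, den_reg rfl, hs₁, den_reg rfl]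
    have fE : s₂.edge = s.edge := State.edge_congr f0 (by rw [hs₂, den_arr rfl, ea0])
    have hB := den_findBad s₂
    rw [f0, f2, fE, key] at hB
    have e : simulate.den s = (ite 20 skip (const 6 1)).den (findBad.den s₂) := rfl
    rw [e]
    refine ⟨fun v hv => ?_, fun hA => ?_, fun hA => ?_⟩
    · rw [den_arr rfl, den_arr rfl, key]
      exact labelling_of_ge hv
    · have : (findBad.den s₂).reg 20 = 0 := by
        by_contra h
        obtain ⟨x, hx, hb, -⟩ := hB.2 h
        exact hA x hx hb
      rw [den_ite_of_eq this]
      simp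
    · have : (findBad.den s₂).reg 20 ≠ 0 := fun h => hA (hB.1 h)
      rw [den_ite_of_ne this, den_skip, f6]
  · funext v
    simp only [State.setReg_arr, labelling]
    rw [hs₁, den_initLabels]
    by_cases hv : v < n
    · simp [← hn, hv]
    · simp [← hn, hv, h1 v (by omega)]
  · intro j hj s' h21 hr ha I
    simp only [tick, State.setReg_arr]
    have h0 : s'.reg 0 = n := by rw [hr 0 rfl, e0]
    rw [den_step, labelling, I, h0, h21, hr 2 rfl, hr 3 rfl, e2, e3, ha 4 rfl, ea4,
      State.edge_congr h0 (by rw [ha 0 rfl, ea0])]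

/-- Addition of one in base `b = d + 1`. The carry reaches position `m` exactly when `b ^ m ∣ j +
1`; the carry out of the last position signals that all sequences have been tried. -/
theorem den_nextChoices (s : State) (j : ℕ)
    (h : ∀ m < s.reg 4, s.arr 4 m = j / (s.reg 2 + 1) ^ m % (s.reg 2 + 1)) :
    (∀ m < s.reg 4, (nextChoices.den s).arr 4 m =
      (j + 1) / (s.reg 2 + 1) ^ m % (s.reg 2 + 1)) ∧
    (nextChoices.den s).reg 24 = if (s.reg 2 + 1) ^ s.reg 4 ∣ j + 1 then 1 else 0 := by
  set b := s.reg 2 + 1 with hb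
  set N := s.reg 4 with hN
  have key := den_rep_induct (s.setReg 24 1) (i := 21) (N := 4)
    (p := ite 24 (load 10 4 21 ;; differ 10 2 ;;
      ite 12 (incr 10 ;; store 4 21 10 ;; const 24 0) (const 10 0 ;; store 4 21 10)) skip)
    (fun m₀ s' => (∀ m < N, s'.arr 4 m = (if m < m₀ then j + 1 else j) / b ^ m % b) ∧
      s'.reg 24 = if b ^ m₀ ∣ j + 1 then 1 else 0) (by decide) rfl ?_ ?_
  · have e : (s.setReg 24 1).reg 4 = N := by simp [hN]
    rw [e] at key
    refine ⟨fun m hm => ?_, key.2⟩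
    have := key.1 m hm
    rw [if_pos hm] at this
    exact this
  · refine ⟨fun m hm => ?_, by simp⟩
    simpa using h m hm
  · intro m₀ hm₀ s' h21 hr ha ⟨I1, I2⟩
    have hm₀ : m₀ < N := by simpa [hN] using hm₀
    have h2 : s'.reg 2 = s.reg 2 := by rw [hr 2 rfl]; simp
    have hdig : s'.arr 4 m₀ = j / b ^ m₀ % b := by
      rw [I1 m₀ hm₀, if_neg (by omega)]
    have hbm : 0 < b ^ m₀ := Nat.pow_pos (by omega)
    have other : ∀ (f : ℕ → ℕ), (∀ m, m ≠ m₀ → f m = s'.arr 4 m) →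
        f m₀ = (j + 1) / b ^ m₀ % b →
        ∀ m < N, f m = (if m < m₀ + 1 then j + 1 else j) / b ^ m % b := by
      intro f hf hf0 m hm
      by_cases hmm : m = m₀
      · subst hmm
        rw [hf0, if_pos (by omega)]
      · rw [hf m hmm, I1 m hm]
        have : m < m₀ + 1 ↔ m < m₀ := by omega
        simp only [this]
    by_cases hc : b ^ m₀ ∣ j + 1
    · rw [if_pos hc] at I2
      have hq : (j + 1) / b ^ m₀ = j / b ^ m₀ + 1 := Nat.succ_div_of_dvd hc
      have hdvd : b ^ (m₀ + 1) ∣ j + 1 ↔ b ∣ j / b ^ m₀ + 1 := by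
        rw [← hq, pow_succ, Nat.dvd_div_iff_mul_dvd hc]
      have hlt := Nat.mod_lt (j / b ^ m₀) (show b > 0 by omega)
      rw [den_ite_of_ne (by omega)]
      simp only [den_seq]
      by_cases hx : j / b ^ m₀ % b = s.reg 2
      · have hdv : b ∣ j / b ^ m₀ + 1 := by
          apply Nat.dvd_of_mod_eq_zero
          rw [Nat.add_mod, hx]
          simp [hb]
        rw [den_ite_of_eq ((den_differ _ _ _ (by decide) (by decide)).2 (by
          simp [h21, hdig, hx, h2]))]
        refine ⟨other _ (fun m hm => ?_) ?_, ?_⟩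
        · simp [tick, h21, hm]
        · simp [tick, h21, hq, Nat.mod_eq_zero_of_dvd hdv]
        · simp [tick, I2, hdvd, hdv]
      · have hmod : (j / b ^ m₀ + 1) % b = j / b ^ m₀ % b + 1 := by
          rw [Nat.add_mod, Nat.mod_eq_of_lt (a := 1) (by omega), Nat.mod_eq_of_lt (by omega)]
        have hdv : ¬ b ∣ j / b ^ m₀ + 1 := fun h' => by
          have := Nat.mod_eq_zero_of_dvd h'
          omega
        rw [den_ite_of_ne (mt (den_differ _ _ _ (by decide) (by decide)).1 (by
          simpa [h21, hdig, h2] using hx))]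
        refine ⟨other _ (fun m hm => ?_) ?_, ?_⟩
        · simp [tick, incr, h21, hm]
        · simp [tick, incr, h21, hq, hmod, hdig]
        · simp [tick, incr, hdvd, hdv]
    · rw [if_neg hc] at I2
      rw [den_ite_of_eq I2]
      refine ⟨other _ (fun m hm => by simp [tick]) ?_, ?_⟩
      · simp [tick, hdig, Nat.succ_div_of_not_dvd hc]
      · have : ¬ b ^ (m₀ + 1) ∣ j + 1 := fun h' => hc ((pow_dvd_pow b (by omega)).trans h')
        simp [tick, I2, this]

end Cmd

end MaxDegContraction

namespace MaxDegContraction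

open SimpleGraph

/-! ### Spanning forests -/

theorem eq_of_reachable {V W : Type*} {H : SimpleGraph V} {f : V → W}
    (h : ∀ u v, H.Adj u v → f u = f v) {u v : V} (huv : H.Reachable u v) : f u = f v := by
  obtain ⟨p⟩ := huv
  induction p with
  | nil => rfl
  | cons hadj _ ih => exact (h _ _ hadj).trans ih

/-- Here `f` labels the components. A new edge `ab` merges at most the components of `a` and `b`,
which amounts to replacing the label `f b` by `f a`. -/
theorem reachable_insert_iff {V : Type*} [DecidableEq V] {S : Set (Sym2 V)} {f : V → V}
    (hf : ∀ u v, f u = f v ↔ (fromEdgeSet S).Reachable u v) (a b u v : V) :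
    (if f u = f b then f a else f u) = (if f v = f b then f a else f v) ↔
      (fromEdgeSet (insert s(a, b) S)).Reachable u v := by
  have hmono : ∀ u v, f u = f v → (fromEdgeSet (insert s(a, b) S)).Reachable u v := fun u v h =>
    ((hf u v).1 h).mono (fromEdgeSet_mono (Set.subset_insert _ _))
  have hab : (fromEdgeSet (insert s(a, b) S)).Reachable a b := by
    by_cases h : a = b
    · rw [h]
    · exact Adj.reachable ((fromEdgeSet_adj _).2 ⟨Set.mem_insert _ _, h⟩)
  constructor
  · intro h
    split_ifs at h with h1 h2 h2
    · exact hmono _ _ (h1.trans h2.symm)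
    · exact (hmono _ _ h1).trans (hab.symm.trans (hmono _ _ h))
    · exact (hmono _ _ h).trans (hab.trans (hmono _ _ h2.symm))
    · exact hmono _ _ h
  · refine eq_of_reachable (f := fun v => if f v = f b then f a else f v) fun x y hxy => ?_
    rw [fromEdgeSet_adj, Set.mem_insert_iff] at hxy
    obtain ⟨h | h, hne⟩ := hxy
    · rcases Sym2.eq_iff.1 h with ⟨rfl, rfl⟩ | ⟨rfl, rfl⟩ <;> simp
    · have : f x = f y := (hf x y).2 (Adj.reachable ((fromEdgeSet_adj _).2 ⟨h, hne⟩))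
      simp only [this]

/-- A finite set of edges contains a spanning forest, whose number of edges is the number of
vertices minus the number of components. -/
theorem exists_spanning_forest {V : Type*} [Fintype V] [DecidableEq V] (S : Finset (Sym2 V)) :
    ∃ F ⊆ S, ∃ f : V → V,
      (∀ u v, f u = f v ↔ (fromEdgeSet (S : Set (Sym2 V))).Reachable u v) ∧
      (∀ u v, f u = f v ↔ (fromEdgeSet (F : Set (Sym2 V))).Reachable u v) ∧
      (Finset.univ.image f).card + F.card = Fintype.card V := by
  induction S using Finset.induction_on with
  | empty => exact ⟨∅, le_rfl, id, by simp, by simp, by simp⟩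
  | insert e S he ih =>
    obtain ⟨F, hFS, f, hS, hF, hcard⟩ := ih
    induction e using Sym2.ind with
    | _ a b =>
    have hS' := reachable_insert_iff hS a b
    have hF' := reachable_insert_iff hF a b
    -- An edge inside a component is left out of the forest; an edge between two components joins
    -- the forest and removes the label `f b`.
    by_cases hab : f a = f b
    · refine ⟨F, hFS.trans (Finset.subset_insert _ _), f, fun u v => ?_, hF, hcard⟩
      rw [Finset.coe_insert, ← hS' u v]
      have : ∀ v, (if f v = f b then f a else f v) = f v := fun v => by
        split_ifs with h
        · rw [hab, h]
        · rfl
      rw [this, this]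
    · refine ⟨insert s(a, b) F, Finset.insert_subset_insert _ hFS,
        fun v => if f v = f b then f a else f v, ?_, ?_, ?_⟩
      · simpa only [Finset.coe_insert] using hS'
      · simpa only [Finset.coe_insert] using hF'
      · have him : (Finset.univ.image fun v => if f v = f b then f a else f v) =
            (Finset.univ.image f).erase (f b) := by
          ext y
          simp only [Finset.mem_image, Finset.mem_univ, true_and, Finset.mem_erase]
          constructor
          · rintro ⟨v, rfl⟩
            split_ifs with h
            · exact ⟨hab, a, rfl⟩
            · exact ⟨h, v, rfl⟩
          · rintro ⟨hy, v, rfl⟩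
            exact ⟨v, if_neg hy⟩
        have hmem : f b ∈ Finset.univ.image f := Finset.mem_image_of_mem _ (Finset.mem_univ _)
        have hpos := Finset.card_pos.2 ⟨_, hmem⟩
        rw [him, Finset.card_erase_of_mem hmem,
          Finset.card_insert_of_notMem fun h => he (hFS h)]
        omega

/-! ### Numbers of classes -/

/-- The number of classes of a labelling. -/
def numClasses (n : ℕ) (lab : ℕ → ℕ) : ℕ := (Finset.univ.image fun v : Fin n => lab v).card

/-- On `s` the map `g` factors through `f`. -/
theorem card_image_le_card_image {α β γ : Type*} [DecidableEq β] [DecidableEq γ]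
    {s : Finset α} {f : α → β} {g : α → γ}
    (h : ∀ u ∈ s, ∀ v ∈ s, f u = f v → g u = g v) : (s.image g).card ≤ (s.image f).card := by
  have hex : ∀ y ∈ s.image g, ∃ u ∈ s, g u = y := fun y hy => by simpa using hy
  rcases s.eq_empty_or_nonempty with rfl | ⟨u₀, -⟩
  · simp
  have : Nonempty α := ⟨u₀⟩
  choose! r hr hgr using hex
  refine Finset.card_le_card_of_injOn (fun y => f (r y))
    (fun y hy => Finset.mem_image_of_mem _ (hr y hy)) fun y hy z hz hyz => ?_
  rw [← hgr y hy, ← hgr z hz]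
  exact h _ (hr y hy) _ (hr z hz) hyz

theorem numClasses_le_relabel (n a b : ℕ) (lab : ℕ → ℕ) :
    numClasses n lab ≤ numClasses n (relabel n a b lab) + 1 := by
  have : (Finset.univ.image fun v : Fin n => lab v).erase b ⊆
      Finset.univ.image fun v : Fin n => relabel n a b lab v := by
    intro y hy
    simp only [Finset.mem_erase, Finset.mem_image, Finset.mem_univ, true_and] at hy ⊢
    obtain ⟨hy, v, rfl⟩ := hy
    exact ⟨v, if_neg fun h => hy h.2⟩
  have h := Finset.card_le_card this
  have h' := Finset.pred_card_le_card_erase (a := b) (s := Finset.univ.image fun v : Fin n => lab v)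
  simp only [numClasses]
  omega

theorem numClasses_relabel_lt {n a b : ℕ} {lab : ℕ → ℕ} (hab : a ≠ b)
    (ha : ∃ v < n, lab v = a) (hb : ∃ v < n, lab v = b) :
    numClasses n (relabel n a b lab) < numClasses n lab := by
  obtain ⟨u, hu, rfl⟩ := ha
  obtain ⟨w, hw, rfl⟩ := hb
  refine Finset.card_lt_card ((Finset.ssubset_iff_of_subset ?_).2 ⟨lab w, ?_, ?_⟩)
  · intro y hy
    simp only [Finset.mem_image, Finset.mem_univ, true_and] at hy ⊢
    obtain ⟨v, rfl⟩ := hy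
    simp only [relabel, v.isLt, true_and]
    split_ifs with h
    · exact ⟨⟨u, hu⟩, rfl⟩
    · exact ⟨v, rfl⟩
  · exact Finset.mem_image.2 ⟨⟨w, hw⟩, Finset.mem_univ _, rfl⟩
  · simp only [Finset.mem_image, Finset.mem_univ, true_and, not_exists]
    intro v
    simp only [relabel, v.isLt, true_and]
    split_ifs with h
    · exact hab
    · exact h

/-! ### Lists of neighbours, and the number of classes along the merging steps. -/

theorem mem_nbrList {n : ℕ} {E : ℕ → ℕ → Prop} {lab : ℕ → ℕ} {x m y : ℕ} :
    y ∈ nbrList n E lab x m ↔ y = x ∨ y < m ∧ y ≠ x ∧ Joined n E lab x y := by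
  simp [nbrList]

theorem nodup_nbrList {n : ℕ} {E : ℕ → ℕ → Prop} {lab : ℕ → ℕ} {x m : ℕ} :
    (nbrList n E lab x m).Nodup := by
  refine List.nodup_cons.2 ⟨?_, List.nodup_range.filter _⟩
  simp

theorem getD_mem {l : List ℕ} {i : ℕ} (h : i < l.length) : l.getD i 0 ∈ l := by
  rw [List.getD_eq_getElem _ _ h]
  exact List.getElem_mem h

theorem mergeStep_lt {n d : ℕ} {E : ℕ → ℕ → Prop} {i r : ℕ} {lab : ℕ → ℕ}
    (h : ∀ v < n, lab v < n) : ∀ v < n, mergeStep n d E i r lab v < n := by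
  classical
  intro v hv
  by_cases hex : ∃ x, x < n ∧ Bad n d E lab x
  · rw [mergeStep_of_first (Nat.find_spec hex).1 (Nat.find_spec hex).2
      fun y hy hb => Nat.find_min hex hy ⟨hy.trans (Nat.find_spec hex).1, hb⟩]
    split_ifs with hlt
    · simp only [relabel]
      split_ifs
      · rcases mem_nbrList.1 (getD_mem (show i < (nbrList n E lab (Nat.find hex) n).length by omega)) with h' | h'
        · rw [h']; exact (Nat.find_spec hex).1
        · exact h'.1
      · exact h v hv
    · exact h v hv
  · rw [mergeStep_of_forall_not fun x hx hb => hex ⟨x, hx, hb⟩]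
    exact h v hv

theorem labelling_lt {n d K : ℕ} {E : ℕ → ℕ → Prop} {g : ℕ → ℕ} (m : ℕ) :
    ∀ v < n, labelling n d K E g m v < n := by
  induction m with
  | zero => intro v hv; simp [labelling, hv]
  | succ m ih => exact mergeStep_lt ih

theorem numClasses_le_mergeStep {n d : ℕ} {E : ℕ → ℕ → Prop} {i r : ℕ} {lab : ℕ → ℕ} :
    numClasses n lab ≤ numClasses n (mergeStep n d E i r lab) + 1 := by
  unfold mergeStep
  split_ifs
  · simp only
    split_ifs
    · exact numClasses_le_relabel _ _ _ _
    · omega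
  · omega

theorem numClasses_labelling_zero {n d K : ℕ} {E : ℕ → ℕ → Prop} {g : ℕ → ℕ} :
    numClasses n (labelling n d K E g 0) = n := by
  have : (fun v : Fin n => labelling n d K E g 0 v) = fun v : Fin n => (v : ℕ) := by
    funext v
    simp [labelling]
  rw [numClasses, this, Finset.card_image_of_injective _ Fin.val_injective, Finset.card_univ,
    Fintype.card_fin]

/-- Whatever the choices, a step destroys at most one class. For soundness this bounds the number of
contracted edges. -/
theorem le_numClasses_labelling {n d K : ℕ} {E : ℕ → ℕ → Prop} {g : ℕ → ℕ} (m : ℕ) :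
    n ≤ numClasses n (labelling n d K E g m) + m := by
  induction m with
  | zero => exact numClasses_labelling_zero.ge
  | succ m ih =>
    have := numClasses_le_mergeStep (n := n) (d := d) (E := E) (i := g m) (r := g (m + K))
      (lab := labelling n d K E g m)
    rw [labelling]
    omega

/-! ### Soundness -/

/-- `F` is a spanning forest of the edges inside classes. Its components refine the classes, and
coincide with them because no class is disconnected. Thus `G / F` is the graph of classes, and `F`
has `n - numClasses n lab` edges. -/
theorem isYes_of_labelling {n k d : ℕ} {G : SimpleGraph (Fin n)} {E : ℕ → ℕ → Prop}
    (hE : ∀ u v : Fin n, E u v ↔ G.Adj u v) {lab : ℕ → ℕ} (hlt : ∀ v < n, lab v < n)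
    (hcard : n ≤ numClasses n lab + k) (hgood : ∀ x < n, ¬ Bad n d E lab x) : IsYes G k d := by
  classical
  obtain ⟨F, hFS, f, hS, hF, hfcard⟩ := exists_spanning_forest
    (Finset.univ.filter fun e : Sym2 (Fin n) => e ∈ G.edgeSet ∧
      ∀ u v, e = s(u, v) → lab u = lab v)
  have hadj : ∀ u v, G.Adj u v → lab u = lab v → (fromEdgeSet
      ((Finset.univ.filter fun e : Sym2 (Fin n) => e ∈ G.edgeSet ∧
        ∀ u v, e = s(u, v) → lab u = lab v : Finset (Sym2 (Fin n))) : Set _)).Adj u v := by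
    intro u v huv hl
    rw [fromEdgeSet_adj]
    refine ⟨?_, huv.ne⟩
    simp only [Finset.coe_filter, Finset.mem_univ, true_and, Set.mem_ofPred_eq]
    refine ⟨huv, fun a b hab => ?_⟩
    rcases Sym2.eq_iff.1 hab with ⟨rfl, rfl⟩ | ⟨rfl, rfl⟩
    · exact hl
    · exact hl.symm
  have hlab : ∀ u v, f u = f v ↔ lab u = lab v := by
    intro u v
    constructor
    · intro h
      refine eq_of_reachable (f := fun v : Fin n => lab v) (fun a b hab => ?_) ((hS u v).1 h)
      rw [fromEdgeSet_adj] at hab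
      simp only [Finset.coe_filter, Finset.mem_univ, true_and, Set.mem_ofPred_eq] at hab
      exact hab.1.2 a b rfl
    · intro h
      by_contra hne
      refine hgood (lab u) (hlt u u.isLt) (Or.inr ⟨u, u.isLt, v, v.isLt, rfl, h.symm, fun hl => ?_⟩)
      -- The component label `f` is the test function that separates `u` from `v`; its default value
      -- is never evaluated.
      have := hl (fun w => if hw : w < n then (f ⟨w, hw⟩ : ℕ) else 0) fun a ha b hb hab hl => by
        simp only [ha, hb, dif_pos]
        rw [(hS ⟨a, ha⟩ ⟨b, hb⟩).2 (hadj _ _ ((hE ⟨a, ha⟩ ⟨b, hb⟩).1 hab) hl).reachable]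
      simp only [Fin.is_lt, dif_pos] at this
      exact hne (Fin.ext this)
  refine ⟨F, fun e he => ?_, ?_, fun A => ?_⟩
  · exact (Finset.mem_filter.1 (hFS he)).2.1
  · have h1 : numClasses n lab ≤ (Finset.univ.image f).card :=
      card_image_le_card_image fun u _ v _ h => (hlab u v).1 h
    rw [Fintype.card_fin] at hfcard
    omega
  · have hex : ∀ B : (fromEdgeSet (F : Set (Sym2 (Fin n)))).ConnectedComponent,
        ∃ u, (fromEdgeSet (F : Set (Sym2 (Fin n)))).connectedComponentMk u = B :=
      ConnectedComponent.ind fun u => ⟨u, rfl⟩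
    choose out hout using hex
    have hmk : ∀ (B : (fromEdgeSet (F : Set (Sym2 (Fin n)))).ConnectedComponent) (u : Fin n),
        u ∈ B.supp → lab u = lab (out B) := by
      intro B u hu
      rw [← hlab, hF]
      refine ConnectedComponent.exact ?_
      rw [ConnectedComponent.mem_supp_iff] at hu
      rw [hu]
      exact (hout B).symm
    set x := lab (out A) with hx
    set T := (Finset.range n).filter fun y => y ≠ x ∧ Joined n E lab x y with hT
    have hTd : T.card ≤ d := by
      by_contra h
      refine hgood x (hlt _ (Fin.is_lt _)) (Or.inl ?_)
      -- The list starts with `x` itself, hence the threshold `d + 1` in `Bad` for more than `d`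
      -- neighbours.
      have : T.card = ((List.range n).filter fun y => y ≠ x ∧ Joined n E lab x y).length := rfl
      rw [nbrList, List.length_cons, ← this]
      omega
    refine le_trans ?_ hTd
    rw [← Set.ncard_coe_finset]
    refine Set.ncard_le_ncard_of_injOn
      (fun B : (fromEdgeSet (F : Set (Sym2 (Fin n)))).ConnectedComponent => lab (out B))
      (fun B hB => ?_) (fun B _ C _ hBC => ?_) (Finset.finite_toSet _)
    · obtain ⟨hne, u, hu, v, hv, huv⟩ := hB
      simp only [hT, Finset.coe_filter, Finset.mem_range, Set.mem_ofPred_eq]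
      refine ⟨hlt _ (Fin.is_lt _), fun h => hne ?_, u, u.isLt, v, v.isLt, (hE u v).2 huv,
        hmk A u hu, hmk B v hv⟩
      rw [hx, ← hlab, hF] at h
      rw [← hout A, ← hout B]
      exact (ConnectedComponent.sound h).symm
    · have h : lab (out B) = lab (out C) := hBC
      rw [← hlab, hF] at h
      rw [← hout B, ← hout C]
      exact ConnectedComponent.sound h

theorem isYes_of_accepts {n k d K : ℕ} {G : SimpleGraph (Fin n)} {E : ℕ → ℕ → Prop}
    (hE : ∀ u v : Fin n, E u v ↔ G.Adj u v) (hK : K ≤ k) {g : ℕ → ℕ}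
    (h : Accepts n d K E g) : IsYes G k d :=
  isYes_of_labelling hE (labelling_lt K)
    ((le_numClasses_labelling K).trans (Nat.add_le_add_left hK _)) h

/-! ### Completeness -/

/-- If the classes of `lab` lie in components of `F`, where contracting `F` gives maximum degree at
most `d`, and some class is bad, then two classes at small positions of its list lie in the same
component. -/
theorem exists_pair_of_bad {n d : ℕ} {G : SimpleGraph (Fin n)} {E : ℕ → ℕ → Prop}
    (hE : ∀ u v : Fin n, E u v ↔ G.Adj u v) {F : Set (Sym2 (Fin n))} (hFG : F ⊆ G.edgeSet)
    (hdeg : ∀ A, ((contract G F).neighborSet A).ncard ≤ d) {lab : ℕ → ℕ}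
    (hlt : ∀ v < n, lab v < n)
    (hlab : ∀ u v : Fin n, lab u = lab v → (fromEdgeSet F).Reachable u v) {x : ℕ}
    (hbad : Bad n d E lab x) :
    ∃ i j, i < j ∧ j ≤ d + 1 ∧ j < (nbrList n E lab x n).length ∧ ∃ u v : Fin n,
      lab u = (nbrList n E lab x n).getD i 0 ∧ lab v = (nbrList n E lab x n).getD j 0 ∧
      (fromEdgeSet F).Reachable u v := by
  classical
  set l := nbrList n E lab x n with hl
  have hl0 : l.getD 0 0 = x := rfl
  by_cases hlen : d + 1 < l.length
  · have hnb : ∀ t, t + 1 < l.length → Joined n E lab x (l.getD (t + 1) 0) := by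
      intro t ht
      rcases mem_nbrList.1 (getD_mem ht) with h | h
      · exfalso
        have h := h.trans hl0.symm
        rw [List.getD_eq_getElem _ _ ht, List.getD_eq_getElem _ _ (by omega)] at h
        exact absurd ((List.Nodup.getElem_inj_iff nodup_nbrList).1 h) (by omega)
      · exact h.2.2
    have hex : ∀ t : Fin (d + 2), ∃ v : Fin n, lab v = l.getD t 0 := by
      rintro ⟨t, ht⟩
      cases t with
      | zero =>
        obtain ⟨u, hu, -, -, -, h, -⟩ := hnb 0 (by omega)
        exact ⟨⟨u, hu⟩, h⟩
      | succ t =>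
        obtain ⟨-, -, v, hv, -, -, h⟩ := hnb t (by omega)
        exact ⟨⟨v, hv⟩, h⟩
    choose rep hrep using hex
    -- Pigeonhole on `x` and its first `d + 1` neighbours: if they lay in `d + 2` distinct
    -- components, the component of `x` would have `d + 1` neighbours in `G / F`.
    by_cases hinj : Function.Injective fun t => (fromEdgeSet F).connectedComponentMk (rep t)
    · exfalso
      have hsub : (Set.range fun t : Fin (d + 1) =>
          (fromEdgeSet F).connectedComponentMk (rep t.succ)) ⊆
          (contract G F).neighborSet ((fromEdgeSet F).connectedComponentMk (rep 0)) := by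
        rintro _ ⟨t, rfl⟩
        obtain ⟨u, hu, v, hv, huv, hux, hvy⟩ := hnb t (by omega)
        refine ⟨fun h => absurd (hinj h) (Fin.succ_ne_zero t).symm, ⟨u, hu⟩, ?_, ⟨v, hv⟩, ?_,
          (hE ⟨u, hu⟩ ⟨v, hv⟩).1 huv⟩
        · exact ConnectedComponent.sound (hlab ⟨u, hu⟩ _ (hux.trans (hrep 0).symm))
        · exact ConnectedComponent.sound (hlab ⟨v, hv⟩ _ (hvy.trans (hrep t.succ).symm))
      have h1 := Set.ncard_le_ncard hsub (Set.toFinite _)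
      have h2 := hdeg ((fromEdgeSet F).connectedComponentMk (rep 0))
      rw [← Set.image_univ, Set.ncard_image_of_injective _
        (fun a b hab => Fin.succ_injective _ (hinj hab)), Set.ncard_univ, Nat.card_fin] at h1
      omega
    · obtain ⟨a, b, hab, hne⟩ : ∃ a b, (fromEdgeSet F).connectedComponentMk (rep a) =
          (fromEdgeSet F).connectedComponentMk (rep b) ∧ a ≠ b := by
        simpa [Function.Injective] using hinj
      have hr := ConnectedComponent.exact hab
      rcases lt_or_gt_of_ne hne with h | h
      · exact ⟨a, b, h, by omega, by omega, rep a, rep b, hrep a, hrep b, hr⟩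
      · exact ⟨b, a, h, by omega, by omega, rep b, rep a, hrep b, hrep a, hr.symm⟩
  · obtain ⟨u, hu, v, hv, hux, hvx, hlink⟩ := hbad.resolve_left hlen
    simp only [Linked, not_forall] at hlink
    obtain ⟨c, hc, hcuv⟩ := hlink
    obtain ⟨p⟩ := hlab ⟨u, hu⟩ ⟨v, hv⟩ (hux.trans hvx.symm)
    -- The class `x` has at most `d` neighbours here, and `c` witnesses that `u` and `v` are not
    -- linked. The `F`-walk from `u` to `v` leaves the part of `x` where `c` equals `c u`. The edge
    -- where it does so cannot end in `x`, as `c` is constant along edges inside classes; it leads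
    -- to a neighbour of `x` in the same component.
    obtain ⟨e, -, he1, he2⟩ := p.exists_boundary_dart {w : Fin n | lab w = x ∧ c w = c u}
      ⟨hux, rfl⟩ fun h => hcuv h.2.symm
    have hadj := e.adj
    have hG : G.Adj e.fst e.snd := hFG ((fromEdgeSet_adj _).1 hadj).1
    have hne : lab e.snd ≠ x := by
      intro h
      refine he2 ⟨h, ?_⟩
      rw [← he1.2]
      exact (hc _ e.fst.isLt _ e.snd.isLt ((hE _ _).2 hG) (he1.1.trans h.symm)).symm
    have hmem : (lab e.snd) ∈ l := mem_nbrList.2 (Or.inr ⟨hlt _ e.snd.isLt, hne,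
      e.fst, e.fst.isLt, e.snd, e.snd.isLt, (hE _ _).2 hG, he1.1, rfl⟩)
    obtain ⟨t, ht, htl⟩ := List.mem_iff_getElem.1 hmem
    have ht0 : t ≠ 0 := by
      rintro rfl
      exact hne htl.symm
    refine ⟨0, t, by omega, by omega, ht, e.fst, e.snd, he1.1, ?_, hadj.reachable⟩
    rw [List.getD_eq_getElem _ _ ht, htl]

/-- This allows the choices to be built step by step: fixing the entries for step `m` does not
disturb the earlier steps. -/
theorem labelling_congr {n d K : ℕ} {E : ℕ → ℕ → Prop} {g g' : ℕ → ℕ} {m : ℕ}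
    (h : ∀ i < m, g i = g' i ∧ g (i + K) = g' (i + K)) :
    labelling n d K E g m = labelling n d K E g' m := by
  induction m with
  | zero => rfl
  | succ m ih =>
    rw [labelling, labelling, ih fun i hi => h i (by omega), (h m (by omega)).1,
      (h m (by omega)).2]

theorem exists_mergeStep {n d : ℕ} {G : SimpleGraph (Fin n)} {E : ℕ → ℕ → Prop}
    (hE : ∀ u v : Fin n, E u v ↔ G.Adj u v) {F : Set (Sym2 (Fin n))} (hFG : F ⊆ G.edgeSet)
    (hdeg : ∀ A, ((contract G F).neighborSet A).ncard ≤ d) {lab : ℕ → ℕ}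
    (hlt : ∀ v < n, lab v < n)
    (hlab : ∀ u v : Fin n, lab u = lab v → (fromEdgeSet F).Reachable u v)
    (hbad : ∃ x, x < n ∧ Bad n d E lab x) :
    ∃ i ≤ d, ∃ r ≤ d, numClasses n (mergeStep n d E i r lab) < numClasses n lab ∧
      ∀ u v : Fin n, mergeStep n d E i r lab u = mergeStep n d E i r lab v →
        (fromEdgeSet F).Reachable u v := by
  classical
  obtain ⟨i, j, hij, hjd, hjl, a, b, ha, hb, hr⟩ :=
    exists_pair_of_bad hE hFG hdeg hlt hlab (Nat.find_spec hbad).2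
  -- Positions `i < j ≤ d + 1` are coded by `i` and the gap `j - i - 1`, both at most `d`, so each
  -- choice is one digit in base `d + 1`.
  refine ⟨i, by omega, j - i - 1, by omega, ?_⟩
  have hj : i + (j - i - 1) + 1 = j := by omega
  rw [mergeStep_of_first (Nat.find_spec hbad).1 (Nat.find_spec hbad).2
    fun y hy hb => Nat.find_min hbad hy ⟨hy.trans (Nat.find_spec hbad).1, hb⟩, hj, if_pos hjl]
  refine ⟨numClasses_relabel_lt ?_ ⟨a, a.isLt, ha⟩ ⟨b, b.isLt, hb⟩, fun u v huv => ?_⟩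
  · rw [List.getD_eq_getElem _ _ hjl, List.getD_eq_getElem _ _ (by omega)]
    exact fun h => absurd ((List.Nodup.getElem_inj_iff nodup_nbrList).1 h) (by omega)
  · rw [← ha, ← hb] at huv
    simp only [relabel, Fin.is_lt, true_and] at huv
    split_ifs at huv with h1 h2 h2
    · exact hlab u v (h1.trans h2.symm)
    · exact (hlab _ _ h1).trans (hr.symm.trans (hlab _ _ huv))
    · exact (hlab _ _ huv).trans (hr.trans (hlab _ _ h2.symm))
    · exact hlab _ _ huv

/-- The solution guides the choices: as long as a bad class remains, a merge inside a component of
`F` is available. After `m` such steps either no class is bad or at least `m` classes have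
disappeared. -/
theorem exists_accepts_of_isYes {n k d : ℕ} {G : SimpleGraph (Fin n)} {E : ℕ → ℕ → Prop}
    (hE : ∀ u v : Fin n, E u v ↔ G.Adj u v) (h : IsYes G k d) :
    ∃ g : ℕ → ℕ, (∀ i, g i ≤ d) ∧ Accepts n d (min k n) E g := by
  classical
  obtain ⟨F, hFG, hFk, hdeg⟩ := h
  obtain ⟨F', hF', f, hf, -, hcard⟩ := exists_spanning_forest F
  have hle := Finset.card_le_card hF'
  rw [Fintype.card_fin] at hcard
  have hclasses : ∀ lab : ℕ → ℕ, (∀ u v : Fin n, lab u = lab v →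
      (fromEdgeSet (F : Set (Sym2 (Fin n)))).Reachable u v) → n ≤ numClasses n lab + k := by
    intro lab hlab
    have : (Finset.univ.image f).card ≤ numClasses n lab :=
      card_image_le_card_image fun u _ v _ huv => (hf u v).2 (hlab u v huv)
    omega
  set K := min k n with hK
  have key : ∀ m ≤ K, ∃ g : ℕ → ℕ, (∀ i, g i ≤ d) ∧
      (∀ u v : Fin n, labelling n d K E g m u = labelling n d K E g m v →
        (fromEdgeSet (F : Set (Sym2 (Fin n)))).Reachable u v) ∧
      ((∀ x < n, ¬ Bad n d E (labelling n d K E g m) x) ∨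
        numClasses n (labelling n d K E g m) + m ≤ n) := by
    intro m
    induction m with
    | zero =>
      refine fun _ => ⟨fun _ => 0, fun _ => Nat.zero_le _, fun u v huv => ?_,
        Or.inr numClasses_labelling_zero.le⟩
      simp only [labelling, Fin.is_lt, if_true] at huv
      rw [Fin.ext huv]
    | succ m ih =>
      intro hm
      obtain ⟨g, hg, hlab, hor⟩ := ih (by omega)
      by_cases hbad : ∃ x, x < n ∧ Bad n d E (labelling n d K E g m) x
      · obtain ⟨i, hi, r, hr, hnum, href⟩ :=
          exists_mergeStep hE hFG hdeg (labelling_lt m) hlab hbad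
        have hnum' := hor.resolve_left fun h => by
          obtain ⟨x, hx, hb⟩ := hbad
          exact h x hx hb
        have hcongr : labelling n d K E
            (fun t => if t = m then i else if t = m + K then r else g t) m =
            labelling n d K E g m :=
          labelling_congr fun t ht => ⟨by
            rw [if_neg (by omega), if_neg (by omega)], by
            rw [if_neg (by omega), if_neg (by omega)]⟩
        -- Entries `m` and `m + K` are not read by steps before `m`, because `m < K`.
        refine ⟨fun t => if t = m then i else if t = m + K then r else g t, fun t => ?_, ?_, ?_⟩
        · dsimp only
          split_ifs
          exacts [hi, hr, hg t]
        all_goals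
          rw [labelling, hcongr, if_pos rfl, if_neg (by omega), if_pos rfl]
        · exact href
        · exact Or.inr (by omega)
      · have hgood : ∀ x < n, ¬ Bad n d E (labelling n d K E g m) x :=
          fun x hx hb => hbad ⟨x, hx, hb⟩
        refine ⟨g, hg, ?_, ?_⟩ <;> rw [labelling, mergeStep_of_forall_not hgood]
        · exact hlab
        · exact Or.inl hgood
  obtain ⟨g, hg, hlab, hor⟩ := key K le_rfl
  refine ⟨g, hg, fun x hx hb => ?_⟩
  -- If a class were still bad after `K` steps, one more guided merge would leave fewer than `n - K`
  -- classes. This contradicts the bound `n - k` when `K = k`, and is absurd when `K = n`.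
  obtain ⟨i, hi, r, hr, hnum, href⟩ :=
    exists_mergeStep hE hFG hdeg (labelling_lt K) hlab ⟨x, hx, hb⟩
  have h1 := hor.resolve_left fun h => h x hx hb
  have h2 := hclasses _ href
  omega

end MaxDegContraction

namespace MaxDegContraction

/-! ### The main loop -/

/-- The `j`-th sequence of choices: the digits of `j` in base `b`. -/
def digit (b j m : ℕ) : ℕ := j / b ^ m % b

theorem accepts_congr {n d K : ℕ} {E : ℕ → ℕ → Prop} {g g' : ℕ → ℕ}
    (h : ∀ m < K + K, g m = g' m) : Accepts n d K E g ↔ Accepts n d K E g' := by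
  rw [Accepts, Accepts, labelling_congr fun i hi => ⟨h i (by omega), h (i + K) (by omega)⟩]

/-- `finFunctionFinEquiv` encodes a function by its base `b` digits, and its inverse reads them off
by the formula in `digit`. -/
theorem exists_digits {b N : ℕ} {g : ℕ → ℕ} (hg : ∀ m, g m < b) :
    ∃ j < b ^ N, ∀ m < N, digit b j m = g m := by
  refine ⟨finFunctionFinEquiv fun m : Fin N => (⟨g m, hg m⟩ : Fin b), Fin.is_lt _, fun m hm => ?_⟩
  have h := congrFun (finFunctionFinEquiv.symm_apply_apply
    fun m : Fin N => (⟨g m, hg m⟩ : Fin b)) ⟨m, hm⟩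
  exact congrArg Fin.val h

theorem isYes_iff_exists_accepts {n k d : ℕ} {G : SimpleGraph (Fin n)} {E : ℕ → ℕ → Prop}
    (hE : ∀ u v : Fin n, E u v ↔ G.Adj u v) :
    IsYes G k d ↔ ∃ j < (d + 1) ^ (min k n + min k n),
      Accepts n d (min k n) E (digit (d + 1) j) := by
  constructor
  · intro h
    obtain ⟨g, hg, hA⟩ := exists_accepts_of_isYes hE h
    obtain ⟨j, hj, hd⟩ := exists_digits (N := min k n + min k n) fun m => Nat.lt_succ_of_le (hg m)
    exact ⟨j, hj, (accepts_congr hd).2 hA⟩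
  · rintro ⟨j, -, hA⟩
    exact isYes_of_accepts hE (min_le_left _ _) hA

/-- The state at the start of the `j`-th round of the main loop. -/
structure RoundStart (n d K : ℕ) (E : ℕ → ℕ → Prop) (j : ℕ) (s : State) : Prop where
  reg_zero : s.reg 0 = n
  reg_two : s.reg 2 = d
  reg_three : s.reg 3 = K
  reg_four : s.reg 4 = K + K
  edge : s.edge = E
  label : ∀ v, n ≤ v → s.arr 1 v = 0
  choice : ∀ m < K + K, s.arr 4 m = digit (d + 1) j m

theorem RoundStart.den_round {n d K : ℕ} {E : ℕ → ℕ → Prop} {j : ℕ} {s : State}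
    (h : RoundStart n d K E j s) :
    RoundStart n d K E (j + 1) (Cmd.round.den s) ∧
    (Accepts n d K E (digit (d + 1) j) → (Cmd.round.den s).reg 6 = 1) ∧
    (¬ Accepts n d K E (digit (d + 1) j) → (Cmd.round.den s).reg 6 = s.reg 6) ∧
    ((Cmd.round.den s).reg 5 = 0 ↔ (d + 1) ^ (K + K) ∣ j + 1) := by
  obtain ⟨h0, h2, h3, h4, hE, h1, hc⟩ := h
  have hsim := Cmd.den_simulate s (by rw [h0]; exact h1)
  rw [h0, h2, h3, hE, accepts_congr hc] at hsim
  set s₁ := Cmd.simulate.den s with hs₁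
  have e2 : s₁.reg 2 = d := by rw [hs₁, Cmd.den_reg rfl, h2]
  have e4 : s₁.reg 4 = K + K := by rw [hs₁, Cmd.den_reg rfl, h4]
  have e6 : (Cmd.round.den s).reg 6 = s₁.reg 6 :=
    Cmd.den_reg (c := Cmd.nextChoices ;; Cmd.const 10 1 ;; Cmd.sub 5 10 24) rfl s₁
  have a1 : (Cmd.round.den s).arr 1 = s₁.arr 1 :=
    Cmd.den_arr (c := Cmd.nextChoices ;; Cmd.const 10 1 ;; Cmd.sub 5 10 24) rfl s₁
  have hnext := Cmd.den_nextChoices s₁ j (by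
    rw [e4, e2, hs₁, Cmd.den_arr rfl]; exact hc)
  rw [e2, e4] at hnext
  have r0 : (Cmd.round.den s).reg 0 = s.reg 0 := Cmd.den_reg rfl s
  refine ⟨⟨?_, ?_, ?_, ?_, ?_, ?_, hnext.1⟩, ?_, ?_, ?_⟩
  · rw [r0, h0]
  · rw [Cmd.den_reg rfl, h2]
  · rw [Cmd.den_reg rfl, h3]
  · rw [Cmd.den_reg rfl, h4]
  · rw [State.edge_congr r0 (Cmd.den_arr rfl s), hE]
  · rw [a1]; exact hsim.1
  · rw [e6]; exact hsim.2.1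
  · rw [e6]; exact hsim.2.2
  · have e5 : (Cmd.round.den s).reg 5 = 1 - (Cmd.nextChoices.den s₁).reg 24 := by
      simp [Cmd.round, ← hs₁]
    rw [e5, hnext.2]
    split_ifs with hd <;> simp [hd]

open Classical in
theorem RoundStart.den_round_answer {n d K : ℕ} {E : ℕ → ℕ → Prop} {j : ℕ} {s : State}
    (h : RoundStart n d K E j s)
    (h6 : s.reg 6 = if ∃ i < j, Accepts n d K E (digit (d + 1) i) then 1 else 0) :
    (Cmd.round.den s).reg 6 =
      if ∃ i < j + 1, Accepts n d K E (digit (d + 1) i) then 1 else 0 := by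
  obtain ⟨-, hacc, hrej, -⟩ := h.den_round
  by_cases hj : Accepts n d K E (digit (d + 1) j)
  · rw [hacc hj, if_pos ⟨j, by omega, hj⟩]
  · rw [hrej hj, h6]
    refine if_congr ⟨fun ⟨i, hi, hA⟩ => ⟨i, by omega, hA⟩,
      fun ⟨i, hi, hA⟩ => ⟨i, ?_, hA⟩⟩ rfl rfl
    rcases Nat.lt_succ_iff_lt_or_eq.mp hi with h' | rfl
    · exact h'
    · exact absurd hA hj

open Classical in
-- Induction on `r`, where `r + 1` rounds remain. The loop flag first vanishes when `(d + 1) ^ (K +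
-- K)` divides `j + 1`, that is, in the last round.
theorem runs_mainLoop {n d K B : ℕ} {E : ℕ → ℕ → Prop} (hn : n ≤ B) (hK : K + K ≤ B) (r : ℕ) :
    ∀ (j : ℕ) (s : State), j + r + 1 = (d + 1) ^ (K + K) → RoundStart n d K E j s →
      s.reg 5 ≠ 0 →
      s.reg 6 = (if ∃ i < j, Accepts n d K E (digit (d + 1) i) then 1 else 0) →
      ∃ t s', Runs (.loop 5 Cmd.round.compile) s t s' ∧
        t ≤ (r + 1) * (Cmd.round.cost B + 1) + 1 ∧
        s'.reg 6 = if ∃ i < (d + 1) ^ (K + K), Accepts n d K E (digit (d + 1) i)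
          then 1 else 0 := by
  induction r with
  | zero =>
    intro j s hj hs h5 h6
    obtain ⟨hnext, -, -, h5'⟩ := hs.den_round
    -- All for-loops of a round are bounded by the registers holding `n`, `K` and `2K`, which is
    -- checked by evaluation.
    obtain ⟨t, ht, hrun⟩ := Cmd.runs_compile (bs := [0, 3, 4]) (c := Cmd.round) rfl (B := B)
      (s := s) (by simp [hs.reg_zero, hs.reg_three, hs.reg_four]; omega)
    refine ⟨t + 1 + 1, _, .loopStep h5 hrun (.loopDone (h5'.2 (by rw [← hj]))), by omega, ?_⟩
    rw [← hj]
    exact hs.den_round_answer h6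
  | succ r ih =>
    intro j s hj hs h5 h6
    obtain ⟨hnext, -, -, h5'⟩ := hs.den_round
    obtain ⟨t, ht, hrun⟩ := Cmd.runs_compile (bs := [0, 3, 4]) (c := Cmd.round) rfl (B := B)
      (s := s) (by simp [hs.reg_zero, hs.reg_three, hs.reg_four]; omega)
    obtain ⟨t', s', hrun', ht', h6'⟩ := ih (j + 1) _ (by omega) hnext
      (fun h => absurd (Nat.le_of_dvd (by omega) (h5'.1 h)) (by omega)) (hs.den_round_answer h6)
    refine ⟨t + t' + 1, s', .loopStep h5 hrun hrun', ?_, h6'⟩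
    rw [Nat.succ_mul (r + 1)]
    omega

/-- The algorithm. -/
def algorithm : Program :=
  .seq (.sub 3 1 0) (.seq (.sub 3 1 3) (.seq (.add 4 3 3) (.seq (.const 5 1)
    (.seq (.loop 5 Cmd.round.compile) (.copy 0 6)))))

/-! ### The initial state and the total running time. -/

theorem inputState_edge {n : ℕ} (G : SimpleGraph (Fin n)) (k d : ℕ) (u v : Fin n) :
    (inputState G k d).edge u v ↔ G.Adj u v := by
  classical
  simp only [State.edge, inputState]
  rw [ne_eq, ite_eq_right_iff, Classical.not_imp]
  simp only [if_true, true_and, one_ne_zero, not_false_eq_true, and_true]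
  constructor
  · rintro ⟨i, j, hij, h⟩
    obtain ⟨h1, h2⟩ := pair_index_inj j.isLt v.isLt h
    rwa [Fin.ext h1, Fin.ext h2]
  · exact fun h => ⟨u, v, h, rfl⟩

theorem runs_algorithm {n : ℕ} (G : SimpleGraph (Fin n)) (k d : ℕ) :
    ∃ t s, Runs algorithm (inputState G k d) t s ∧
      t ≤ 2 ^ (2 * (d * k)) * (Cmd.round.cost (2 * n) + 7) ∧
      s.reg 0 = open Classical in if IsYes G k d then 1 else 0 := by
  classical
  set s := inputState G k d with hs
  set K := min k n with hK
  have r0 : s.reg 0 = n := rfl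
  have r1 : s.reg 1 = k := rfl
  have r2 : s.reg 2 = d := rfl
  set s₁ := (((s.setReg 3 (k - n)).setReg 3 K).setReg 4 (K + K)).setReg 5 1 with hs₁
  have h1 := Runs.sub 3 1 0 s
  have h2 := Runs.sub 3 1 3 (s.setReg 3 (k - n))
  have h3 := Runs.add 4 3 3 ((s.setReg 3 (k - n)).setReg 3 K)
  have h4 := Runs.const 5 1 (((s.setReg 3 (k - n)).setReg 3 K).setReg 4 (K + K))
  rw [r0, r1] at h1
  -- Two truncated subtractions compute `min k n = k - (k - n)`. Capping the number of steps at `n`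
  -- makes `2 * n` bound all for-loops, so the cost of a round does not depend on `k`.
  have e2 : (s.setReg 3 (k - n)).reg 1 - (s.setReg 3 (k - n)).reg 3 = K := by
    simp [r1]; omega
  have e3 : ((s.setReg 3 (k - n)).setReg 3 K).reg 3 = K := by simp
  rw [e2] at h2
  rw [e3] at h3
  have hpos : 0 < (d + 1) ^ (K + K) := Nat.pow_pos (by omega)
  have hstart : RoundStart n d K s.edge 0 s₁ := by
    refine ⟨by simp [hs₁, r0], by simp [hs₁, r2], by simp [hs₁], by simp [hs₁], ?_, fun v _ => ?_,
      fun m _ => ?_⟩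
    · exact State.edge_congr (by simp [hs₁]) rfl
    · simp [hs₁, hs, inputState]
    · simp [hs₁, hs, inputState, digit]
  obtain ⟨t, s₂, hrun, ht, h6⟩ := runs_mainLoop (B := 2 * n) (by omega)
    (by omega : K + K ≤ 2 * n) ((d + 1) ^ (K + K) - 1) 0 s₁ (by omega) hstart (by simp [hs₁])
    (by simp [hs₁, hs, inputState])
  refine ⟨1 + (1 + (1 + (1 + (t + 1)))), s₂.setReg 0 (s₂.reg 6),
    .seq h1 (.seq h2 (.seq h3 (.seq h4 (.seq hrun (.copy 0 6 s₂))))), ?_, ?_⟩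
  -- From `d + 1 ≤ 2 ^ d`. The `7` absorbs the test of each round, the last test and the five
  -- instructions outside the loop, as there is at least one round.
  · have hpow : (d + 1) ^ (K + K) ≤ 2 ^ (2 * (d * k)) := by
      calc (d + 1) ^ (K + K) ≤ (2 ^ d) ^ (K + K) := Nat.pow_le_pow_left Nat.lt_two_pow_self _
        _ = 2 ^ (d * (K + K)) := (pow_mul _ _ _).symm
        _ ≤ 2 ^ (2 * (d * k)) := Nat.pow_le_pow_right (by omega) (by
          have : d * (K + K) ≤ d * (k + k) := Nat.mul_le_mul_left d (by omega)
          linarith)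
    have h1 := Nat.mul_le_mul_right (Cmd.round.cost (2 * n) + 7) hpow
    rw [Nat.sub_add_cancel hpos] at ht
    refine le_trans ?_ h1
    generalize Cmd.round.cost (2 * n) = c at *
    nlinarith
  · have hiff := isYes_iff_exists_accepts (k := k) (d := d) (inputState_edge G k d)
    simp only [State.setReg_reg, if_true, h6, hiff]
    rfl

theorem decidesInTime_algorithm :
    ∃ C : ℕ, DecidesInTime algorithm (fun n k d => C * 2 ^ (C * (d * k)) * (n + 1) ^ C) := by
  obtain ⟨C, hC⟩ := Cmd.cost_le Cmd.round
  refine ⟨C * 2 ^ C + 7, fun n G k d => ?_⟩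
  obtain ⟨t, s, hrun, ht, h0⟩ := runs_algorithm G k d
  refine ⟨t, s, hrun, ht.trans ?_, h0⟩
  set D := C * 2 ^ C + 7 with hD
  have hCD : C ≤ D := by
    have := Nat.le_mul_of_pos_right C (Nat.two_pow_pos C)
    omega
  have hcost : Cmd.round.cost (2 * n) + 7 ≤ D * (n + 1) ^ D := by
    have h1 : Cmd.round.cost (2 * n) ≤ C * 2 ^ C * (n + 1) ^ C := by
      -- The factor `2 ^ C` comes from `2 * n + 1 ≤ 2 * (n + 1)`.
      refine (hC (2 * n)).trans ?_
      rw [Nat.mul_assoc, ← Nat.mul_pow]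
      exact Nat.mul_le_mul_left C (Nat.pow_le_pow_left (by omega) C)
    have h2 : (n + 1) ^ C ≤ (n + 1) ^ D := Nat.pow_le_pow_right (by omega) hCD
    have h3 : 1 ≤ (n + 1) ^ D := Nat.one_le_pow _ _ (by omega)
    have h4 := Nat.mul_le_mul_left (C * 2 ^ C) h2
    calc Cmd.round.cost (2 * n) + 7 ≤ C * 2 ^ C * (n + 1) ^ D + 7 * (n + 1) ^ D := by omega
      _ = D * (n + 1) ^ D := by rw [hD, Nat.add_mul]
  calc 2 ^ (2 * (d * k)) * (Cmd.round.cost (2 * n) + 7)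
      ≤ 2 ^ (D * (d * k)) * (D * (n + 1) ^ D) :=
        Nat.mul_le_mul (Nat.pow_le_pow_right (by omega) (Nat.mul_le_mul_right _ (by omega))) hcost
    _ = D * 2 ^ (D * (d * k)) * (n + 1) ^ D := by ring

end MaxDegContraction

theorem theorem2 :
    ∃ (P : MaxDegContraction.Program) (C : ℕ),
      MaxDegContraction.DecidesInTime P
        (fun n k d => C * 2 ^ (C * (d * k)) * (n + 1) ^ C) := by
  exact ⟨_, MaxDegContraction.decidesInTime_algorithm⟩
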